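/- Setting. Let $C\ge 1$ and $\lambda,\mu,\lambda_{\mathrm{in}},\bar r>0$. A server with $C$ threads is an Erlang loss system with arrival rate $\lambda$ and per-thread service rate $\mu$: the number $c(t)\in\{0,\dots,C\}$ of idle threads is a càdlàg continuous-time Markov chain which jumps from $i$ to $i-1$ at rate $\lambda$ (if $i>0$) and from $i$ to $i+1$ at rate $(C-i)\mu$. Status updates reach the access point (AP) at times $S_0=0$, $S_k=\sum_{i<k}Y_i$, where the gaps $Y_k\ge 0$ are i.i.d. with $\mathbb E[Y_k]=1/\bar r$. With $N(t)=\max\{k:S_k\le t\}$, the AP's cached state is $\hat c(t)=c(S_{N(t)}^-)$ (where $c(0^-):=c(0)$). User tasks reach the AP at the points $\tau_0<\tau_1<\cdots$ of a Poisson process of rate $\lambda_{\mathrm{in}}$ that is independent of the process $\hat c$; the task arriving at $\tau_n$ is forwarded if and only if $\hat c(\tau_n)>0$. Let $F(t)$ be the number of tasks forwarded by time $t$. Put $$B(\rho,C)=\frac{\rho^C/C!}{\sum_{k=0}^C\rho^k/k!},\qquad \rho=\lambda/\mu,\qquad P_{\mathrm{idle}}=1-B(\rho,C).$$ Lemma.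 Suppose the update gaps $(Y_k)_{k\ge0}$ are independent of the server process $(c(t))_{t\ge 0}$. Then, for every initial law of $c$: 1. Almost surely, $\displaystyle\lim_{T\to\infty}\frac1T\int_0^T\mathbf 1_{\{\hat c(t)>0\}}\,dt=P_{\mathrm{idle}}$. 2. If the server is in steady state (the law of $c(t)$ does not depend on $t$), then $\Pr\{c(t)>0\}=\Pr\{\hat c(t)>0\}=P_{\mathrm{idle}}$ for all $t\ge0$, each arriving task is forwarded with probability $\Pr\{\hat c(\tau_n)>0\}=P_{\mathrm{idle}}$, and $\mathbb E[F(t)]=\lambda_{\mathrm{in}}P_{\mathrm{idle}}\,t$ for all $t\ge 0$. 3. Almost surely, $F(t)/t\to\lambda_{\mathrm{in}}P_{\mathrm{idle}}$ as $t\to\infty$. In particular, if the server's arrival rate $\lambda$ is the forwarding rate, i.e. $F(t)/t\to\lambda$ almost surely, then $\lambda=\lambda_{\mathrm{in}}P_{\mathrm{idle}}=\lambda_{\mathrm{in}}\bigl(1-B(\lambda/\mu,C)\bigr)$. 4. If, instead of consulting $\hat c$, each task is forwarded independently with probability $P_{\mathrm{idle}}$ (i.i.d. decisions independent of the task arrivals),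 the forwarded tasks form a Poisson process of rate $\lambda_{\mathrm{in}}P_{\mathrm{idle}}$. -/

import Mathlib

open MeasureTheory ProbabilityTheory Filter Topology
open scoped NNReal ENNReal Nat

noncomputable section

/-- The Erlang-B formula with offered load `ρ` and `C` threads. -/
def erlangB (ρ : ℝ) (C : ℕ) : ℝ :=
  (ρ ^ C / (C ! : ℝ)) / ∑ k ∈ Finset.range (C + 1), ρ ^ k / (k ! : ℝ)

/-- `P_idle = 1 - B(ρ, C)` with `ρ = lam / μ`. -/
def pIdle (lam μ : ℝ) (C : ℕ) : ℝ := 1 - erlangB (lam / μ) C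

/-- Generator of the number of idle threads of the Erlang loss system with `C` threads, arrival
rate `lam` and per-thread service rate `μ`: from `i` idle threads, the process jumps to `i - 1`
at rate `lam` if `i > 0` (a task is admitted; if `i = 0` it is lost) and to `i + 1` at rate
`(C - i) μ` (one of the `C - i` busy threads completes its task). -/
def lossGenerator (C : ℕ) (lam μ : ℝ) : Matrix (Fin (C + 1)) (Fin (C + 1)) ℝ :=
  Matrix.of fun i j =>
    if (j : ℕ) + 1 = i then lam
    else if (j : ℕ) = i + 1 then ((C : ℝ) - (i : ℕ)) * μ
    else if j = i then -((if 0 < (i : ℕ) then lam else 0) + ((C : ℝ) - (i : ℕ)) * μ)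
    else 0

/-- Right-continuous with left limits. -/
def HasCadlagPaths {E : Type*} [TopologicalSpace E] (f : ℝ≥0 → E) : Prop :=
  ∀ t, ContinuousWithinAt f (Set.Ici t) t ∧ ∃ l, Tendsto f (𝓝[<] t) (𝓝 l)

section Processes

variable {Ω : Type*} [MeasurableSpace Ω]

/-- `c t` is the number of idle threads at time `t` of an Erlang loss system: `c` is a
continuous-time Markov chain with càdlàg paths and generator `lossGenerator C lam μ`
(started from an arbitrary initial law). -/
structure IsErlangLossSystem (C : ℕ) (lam μ : ℝ) (c : ℝ≥0 → Ω → Fin (C + 1))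
    (P : Measure Ω) : Prop where
  measurable : ∀ t, Measurable (c t)
  cadlag : ∀ ω, HasCadlagPaths fun t => c t ω
  markov : ∀ (n : ℕ) (t : ℕ → ℝ≥0), Monotone t → ∀ x : ℕ → Fin (C + 1),
    P.real {ω | ∀ i ≤ n, c (t i) ω = x i} =
      P.real {ω | c (t 0) ω = x 0} *
        ∏ i ∈ Finset.range n,
          NormedSpace.exp (((t (i + 1) : ℝ) - (t i : ℝ)) • lossGenerator C lam μ)
            (x i) (x (i + 1))

/-- The one-dimensional laws of the process do not depend on time. For a Markov chain this says
that the process is in steady state. -/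
def InSteadyState {E : Type*} [MeasurableSpace E] (c : ℝ≥0 → Ω → E) (P : Measure Ω) : Prop :=
  ∀ t, P.map (c t) = P.map (c 0)

/-- The inter-update gaps: i.i.d., nonnegative, with mean `1 / r`. -/
structure IsUpdateGaps (Y : ℕ → Ω → ℝ≥0) (r : ℝ) (P : Measure Ω) : Prop where
  measurable : ∀ k, Measurable (Y k)
  indep : iIndepFun Y P
  identDistrib : ∀ k, IdentDistrib (Y k) (Y 0) P P
  integrable : Integrable (fun ω => (Y 0 ω : ℝ)) P
  mean : ∫ ω, (Y 0 ω : ℝ) ∂P = 1 / r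

/-- `N` is the counting process of a homogeneous Poisson process of rate `r`. -/
structure IsPoissonCounting (N : ℝ≥0 → Ω → ℕ) (r : ℝ) (P : Measure Ω) : Prop where
  measurable : ∀ t, Measurable (N t)
  paths : ∀ᵐ ω ∂P, N 0 ω = 0 ∧ Monotone (fun t => N t ω) ∧
    ∀ t, ContinuousWithinAt (fun s => N s ω) (Set.Ici t) t
  indepIncrements : HasIndepIncrements N P
  increments : ∀ s t : ℝ≥0, s ≤ t →
    P.map (fun ω => N t ω - N s ω) = poissonMeasure (r * ((t : ℝ) - (s : ℝ))).toNNReal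

end Processes

section Paths

variable {Ω : Type*}

/-- Arrival time `S_k = ∑_{i < k} Y_i` of the `k`-th status update. -/
def updateTime (Y : ℕ → Ω → ℝ≥0) (k : ℕ) (ω : Ω) : ℝ≥0 := ∑ i ∈ Finset.range k, Y i ω

/-- Index `N(t) = max {k | S_k ≤ t}` of the most recent update at time `t`. -/
def lastUpdate (Y : ℕ → Ω → ℝ≥0) (t : ℝ≥0) (ω : Ω) : ℕ := sSup {k | updateTime Y k ω ≤ t}

/-- The cached state `ĉ(t) = c(S_k⁻)` for `k = N(t)`, the left limit of the server state at the
most recent update (with `c(0⁻) = c(0)`, the value of `Function.leftLim` at `0`). -/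
def cachedState {C : ℕ} (c : ℝ≥0 → Ω → Fin (C + 1)) (Y : ℕ → Ω → ℝ≥0) (t : ℝ≥0) (ω : Ω) :
    Fin (C + 1) :=
  Function.leftLim (fun s => c s ω) (updateTime Y (lastUpdate Y t ω) ω)

/-- Number of tasks among those arriving at the times `τ 0, τ 1, …` that arrive by time `t` and
are selected by `keep`. -/
def taskCount (τ : ℕ → Ω → ℝ≥0) (keep : ℕ → Ω → Prop) (t : ℝ≥0) (ω : Ω) : ℕ :=
  {n | τ n ω ≤ t ∧ keep n ω}.ncard

/-- Number of tasks forwarded by time `t`: the task arriving at time `τ n` is forwarded iff the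
cached state at that time shows an idle thread. -/
def forwardedCount {C : ℕ} (c : ℝ≥0 → Ω → Fin (C + 1)) (Y : ℕ → Ω → ℝ≥0) (τ : ℕ → Ω → ℝ≥0) :
    ℝ≥0 → Ω → ℕ :=
  taskCount τ fun n ω => 0 < cachedState c Y (τ n ω) ω

/-- Fraction of the time interval `[0, T]` during which the cached state shows an idle thread. -/
def cachedIdleFraction {C : ℕ} (c : ℝ≥0 → Ω → Fin (C + 1)) (Y : ℕ → Ω → ℝ≥0) (T : ℝ) (ω : Ω) :
    ℝ :=
  (∫ t in (0 : ℝ)..T, if 0 < cachedState c Y t.toNNReal ω then (1 : ℝ) else 0) / T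

end Paths

/-- `τ 0 < τ 1 < …` are the points of a homogeneous Poisson process of rate `r`. -/
structure IsPoissonArrivals {Ω : Type*} [MeasurableSpace Ω] (τ : ℕ → Ω → ℝ≥0) (r : ℝ)
    (P : Measure Ω) : Prop where
  measurable : ∀ n, Measurable (τ n)
  strictMono : ∀ᵐ ω ∂P, StrictMono fun n => τ n ω
  tendsto : ∀ᵐ ω ∂P, Tendsto (fun n => τ n ω) atTop atTop
  counting : IsPoissonCounting (taskCount τ fun _ _ => True) r P

end

/-! The cache is constant on each interval between consecutive updates, so its idle time up to the
n-th update is the sum of `Y k` times the idle indicator of the server just before update k. By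
independence and Fubini the gap sequence may be frozen, and the question becomes a law of large
numbers for the server observed at deterministic times with deterministic weights. A Doeblin bound
makes the server exponentially ergodic. Hence, for any initial law, the idle indicators centred at
the stationary value `pIdle` have product moments at most K exp(-γ(t - s))
(`IsErlangLossSystem.leftLim_covariance_bound`). Summed against the gaps these decays stay below 1/γ
however the updates are spaced (`sum_mul_exp_neg_le`), which leaves a second moment of order Σ (y_k²
+ y_k). The gaps have only a first moment, but truncation gives Σ Y_k²/(k+1)² < ∞ almost surely, and
this suffices along geometric subsequences. Monotonicity of the accumulated idle time fills in the
rest.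

In steady state the idle probability is constant in time and, by ergodicity, equals `pIdle`.
Sampling at an independent random time preserves it: the update time seen at t depends on the gaps
alone, and the task arrivals are independent of the cache.

The forwarded count is a Stieltjes integral of the cache indicator against the Poisson arrivals,
hence a limit of sums over finer and finer cells. Since the arrivals are independent of the whole
cache process, centred increments over distinct cells stay orthogonal after weighting, so the count
minus `lamIn` times the idle time up to t has second moment at most `lamIn * t`
(`IsPoissonArrivals.integral_sq_cellSum_le`). The same subsequence argument gives the almost sure
rate.

For thinning, an independent mark replaces w by 1 + p(w - 1) in the generating function of the
Poisson increments, which turns rate r into r p. On the unit circle these are characteristic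
functions, which determine both the laws and the independence of the thinned increments. -/

/-! ### Matrix exponentials and Doeblin contraction -/

section MatrixExponential

variable {n : Type*} [Fintype n] [DecidableEq n]

theorem hasSum_matrix_exp_apply (A : Matrix n n ℝ) (i j : n) :
    HasSum (fun k : ℕ => (k ! : ℝ)⁻¹ * (A ^ k) i j) (NormedSpace.exp A i j) := by
  let _ : NormedRing (Matrix n n ℝ) := Matrix.linftyOpNormedRing
  let _ : NormedAlgebra ℝ (Matrix n n ℝ) := Matrix.linftyOpNormedAlgebra
  have h := NormedSpace.exp_series_hasSum_exp' (𝕂 := ℝ) A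
  have h' : HasSum (fun k : ℕ => ((k ! : ℝ)⁻¹ • A ^ k) i j) (NormedSpace.exp A i j) :=
    Pi.hasSum.1 (Pi.hasSum.1 h i) j
  simpa using h'

/-- Only the zeroth term of the exponential series survives on a kernel vector. For a generator this
yields row sums 1 and, after transposition, invariance of the stationary law. -/
theorem matrix_exp_mulVec_of_mulVec_eq_zero {A : Matrix n n ℝ} {v : n → ℝ} (h : A.mulVec v = 0) :
    (NormedSpace.exp A).mulVec v = v := by
  funext i
  have h1 : HasSum (fun k : ℕ => ∑ j, (k ! : ℝ)⁻¹ * (A ^ k) i j * v j)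
      (∑ j, NormedSpace.exp A i j * v j) :=
    hasSum_sum fun j _ => (hasSum_matrix_exp_apply A i j).mul_right _
  have h2 : ∀ k : ℕ, ∑ j, (k ! : ℝ)⁻¹ * (A ^ k) i j * v j
      = (k ! : ℝ)⁻¹ * ((A ^ k).mulVec v) i := fun k => by
    simp only [Matrix.mulVec, dotProduct, Finset.mul_sum, mul_assoc]
  have h3 : HasSum (fun k : ℕ => ∑ j, (k ! : ℝ)⁻¹ * (A ^ k) i j * v j) (v i) := by
    have h4 := hasSum_single (f := fun k : ℕ => ∑ j, (k ! : ℝ)⁻¹ * (A ^ k) i j * v j) 0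
      (fun k hk => by
        obtain ⟨m, rfl⟩ := Nat.exists_eq_succ_of_ne_zero hk
        rw [h2, pow_succ, ← Matrix.mulVec_mulVec, h]
        simp)
    have h5 := h2 0
    simp only [pow_zero, Matrix.one_mulVec, Nat.factorial_zero, Nat.cast_one, inv_one,
      one_mul] at h5
    simpa only [pow_zero, Nat.factorial_zero, Nat.cast_one, inv_one, one_mul, h5] using h4
  exact h1.unique h3

theorem matrix_vecMul_exp_of_vecMul_eq_zero {A : Matrix n n ℝ} {v : n → ℝ}
    (h : Matrix.vecMul v A = 0) : Matrix.vecMul v (NormedSpace.exp A) = v := by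
  rw [← Matrix.mulVec_transpose, ← Matrix.exp_transpose]
  exact matrix_exp_mulVec_of_mulVec_eq_zero (by rw [Matrix.mulVec_transpose, h])

theorem matrix_pow_apply_nonneg {A : Matrix n n ℝ} (h : ∀ i j, 0 ≤ A i j) (k : ℕ) :
    ∀ i j, 0 ≤ (A ^ k) i j := by
  induction k with
  | zero => intro i j; rw [pow_zero, Matrix.one_apply]; split_ifs <;> norm_num
  | succ k ih =>
    intro i j
    rw [pow_succ, Matrix.mul_apply]
    exact Finset.sum_nonneg fun l _ => mul_nonneg (ih i l) (h l j)

/-- Uniformization: a multiple of the identity commutes with everything, and for large `a` the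
shifted generator is entrywise nonnegative, so positivity of the exponential can be read off its
series. -/
theorem matrix_exp_eq_shift (A : Matrix n n ℝ) (a : ℝ) (i j : n) :
    NormedSpace.exp A i j = Real.exp (-a) * NormedSpace.exp (A + a • (1 : Matrix n n ℝ)) i j := by
  have h1 : A = (A + a • (1 : Matrix n n ℝ)) + Matrix.diagonal (fun _ : n => -a) := by
    rw [add_assoc, Matrix.smul_one_eq_diagonal, Matrix.diagonal_add]; simp
  have h2 : Commute (A + a • (1 : Matrix n n ℝ)) (Matrix.diagonal (fun _ : n => -a)) := by
    have : Matrix.diagonal (fun _ : n => -a) = (-a) • (1 : Matrix n n ℝ) := by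
      rw [Matrix.smul_one_eq_diagonal]
    rw [this]
    exact (Commute.one_right _).smul_right _
  conv_lhs => rw [h1]
  rw [Matrix.exp_add_of_commute _ _ h2, Matrix.exp_diagonal, Matrix.mul_diagonal, mul_comm]
  congr 1
  rw [Pi.coe_exp, ← Real.exp_eq_exp_ℝ]

theorem matrix_exp_apply_ge {A : Matrix n n ℝ} (h : ∀ i j, 0 ≤ A i j) (k : ℕ) (i j : n) :
    (k ! : ℝ)⁻¹ * (A ^ k) i j ≤ NormedSpace.exp A i j :=
  le_hasSum (hasSum_matrix_exp_apply A i j) k fun l _ =>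
    mul_nonneg (by positivity) (matrix_pow_apply_nonneg h l i j)

/-- The iterates of a stochastic matrix with a column bounded below by `δ` contract
geometrically to the mean under any invariant probability vector. -/
theorem abs_matrix_pow_mulVec_sub_le {A : Matrix n n ℝ} (hA : ∀ i j, 0 ≤ A i j)
    (hA1 : ∀ i, ∑ j, A i j = 1) {z : n} {δ : ℝ} (hz : ∀ i, δ ≤ A i z)
    {w : n → ℝ} (hw : ∀ i, 0 ≤ w i) (hw1 : ∑ i, w i = 1) (hwA : Matrix.vecMul w A = w)
    (v : n → ℝ) (hv0 : ∀ i, 0 ≤ v i) (hv1 : ∀ i, v i ≤ 1) (k : ℕ) (i : n) :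
    |((A ^ k).mulVec v) i - ∑ j, w j * v j| ≤ (1 - δ) ^ k := by
  -- The iterate stays in an interval of length (1 - δ)^k while its `w`-mean is conserved; the mean
  -- is therefore trapped in the same interval.
  have key : ∀ k : ℕ, (∑ j, w j * ((A ^ k).mulVec v) j = ∑ j, w j * v j) ∧
      ∃ a b : ℝ, b - a = (1 - δ) ^ k ∧ ∀ i, a ≤ ((A ^ k).mulVec v) i ∧ ((A ^ k).mulVec v) i ≤ b := by
    intro k
    induction k with
    | zero => exact ⟨by simp, 0, 1, by simp, fun i => by simpa using ⟨hv0 i, hv1 i⟩⟩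
    | succ k ih =>
      obtain ⟨ihm, a, b, hab, ih⟩ := ih
      set u := (A ^ k).mulVec v with hu
      have hs : (A ^ (k + 1)).mulVec v = A.mulVec u := by
        rw [pow_succ', hu, Matrix.mulVec_mulVec]
      rw [hs]
      -- Each row of `A` is a mass δ at `z`, common to all rows, plus a nonnegative remainder of
      -- mass 1 - δ; only the remainder feels the spread between `a` and `b`.
      refine ⟨?_, δ * u z + (1 - δ) * a, δ * u z + (1 - δ) * b, ?_, fun i => ?_⟩
      · have := Matrix.dotProduct_mulVec w A u
        rw [hwA] at this
        simpa [dotProduct, ihm] using this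
      · rw [pow_succ, ← hab]; ring
      · have e : ∀ c : ℝ, A.mulVec u i - (δ * u z + (1 - δ) * c)
            = ∑ j, (A i j - if j = z then δ else 0) * (u j - c) := by
          intro c
          simp only [sub_mul, mul_sub, Finset.sum_sub_distrib, ite_mul, zero_mul,
            Finset.sum_ite_eq', Finset.mem_univ, if_true, ← Finset.sum_mul, hA1,
            Matrix.mulVec, dotProduct]
          ring
        have hp : ∀ j, 0 ≤ A i j - if j = z then δ else 0 := by
          intro j
          split_ifs with h
          · rw [h]; linarith [hz i]
          · linarith [hA i j]
        constructor
        · rw [← sub_nonneg, e]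
          exact Finset.sum_nonneg fun j _ => mul_nonneg (hp j) (by linarith [(ih j).1])
        · rw [← sub_nonpos, e]
          exact Finset.sum_nonpos fun j _ =>
            mul_nonpos_of_nonneg_of_nonpos (hp j) (by linarith [(ih j).2])
  obtain ⟨hm, a, b, hab, h⟩ := key k
  have h1 : a ≤ ∑ j, w j * v j := by
    rw [← hm]
    calc a = ∑ j, w j * a := by rw [← Finset.sum_mul, hw1, one_mul]
      _ ≤ _ := Finset.sum_le_sum fun j _ => mul_le_mul_of_nonneg_left (h j).1 (hw j)
  have h2 : ∑ j, w j * v j ≤ b := by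
    rw [← hm]
    calc _ ≤ ∑ j, w j * b :=
          Finset.sum_le_sum fun j _ => mul_le_mul_of_nonneg_left (h j).2 (hw j)
      _ = b := by rw [← Finset.sum_mul, hw1, one_mul]
  rw [abs_le, ← hab]
  constructor <;> linarith [(h i).1, (h i).2]

end MatrixExponential

/-! ### The Erlang loss chain: stationary law and ergodicity -/

section LossSystem

variable {C : ℕ} {lam μ : ℝ}

theorem lossGenerator_apply (C : ℕ) (lam μ : ℝ) (i j : Fin (C + 1)) :
    lossGenerator C lam μ i j = if (j : ℕ) + 1 = i then lam
      else if (j : ℕ) = i + 1 then ((C : ℝ) - (i : ℕ)) * μ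
      else if j = i then -((if 0 < (i : ℕ) then lam else 0) + ((C : ℝ) - (i : ℕ)) * μ)
      else 0 := rfl

theorem lossGenerator_row_sum (i : Fin (C + 1)) : ∑ j, lossGenerator C lam μ i j = 0 := by
  -- The three cases are mutually exclusive, so the nested conditional is a sum of three indicators
  -- that can be summed separately.
  obtain ⟨f, hf⟩ : ∃ f : ℕ → ℝ, ∀ j : ℕ, f j = (if j + 1 = (i : ℕ) then lam else 0)
        + (if j = (i : ℕ) + 1 then ((C : ℝ) - (i : ℕ)) * μ else 0)
        + (if j = (i : ℕ) then -((if 0 < (i : ℕ) then lam else 0) + ((C : ℝ) - (i : ℕ)) * μ)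
            else 0) := ⟨_, fun _ => rfl⟩
  have h : ∀ j : Fin (C + 1), lossGenerator C lam μ i j = f j := by
    intro j
    rw [lossGenerator_apply, hf]
    simp only [Fin.ext_iff]
    split_ifs <;> first | omega | simp
  rw [Finset.sum_congr rfl fun j _ => h j, Fin.sum_univ_eq_sum_range f,
    Finset.sum_congr rfl fun j _ => hf j]
  simp only [Finset.sum_add_distrib, Finset.sum_ite_eq', Finset.mem_range, i.2, if_true]
  have hi := i.2
  have h1 : ∑ j ∈ Finset.range (C + 1), (if j + 1 = (i : ℕ) then lam else 0)
      = if 0 < (i : ℕ) then lam else 0 := by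
    rcases Nat.eq_zero_or_pos (i : ℕ) with h0 | h0
    · simp [h0]
    · obtain ⟨m, hm⟩ := Nat.exists_eq_succ_of_ne_zero h0.ne'
      rw [hm] at hi ⊢
      simp only [Nat.succ_eq_add_one, add_left_inj, Finset.sum_ite_eq', Finset.mem_range]
      rw [if_pos (by omega), if_pos (by omega)]
  rw [h1]
  -- At i = C the upward neighbour lies outside the state space, but there the rate (C - i) μ
  -- vanishes as well.
  by_cases hC : (i : ℕ) + 1 < C + 1
  · rw [if_pos hC]; ring
  · rw [if_neg hC]
    have : (C : ℝ) = (i : ℕ) := by exact_mod_cast (show C = (i : ℕ) by omega)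
    rw [this]; ring

/-- The stationary distribution of the number of idle threads. -/
noncomputable def lossStationary (C : ℕ) (lam μ : ℝ) (i : Fin (C + 1)) : ℝ :=
  ((lam / μ) ^ (C - (i : ℕ)) / ((C - (i : ℕ)) ! : ℝ)) /
    ∑ k ∈ Finset.range (C + 1), (lam / μ) ^ k / (k ! : ℝ)

theorem erlang_partition_pos (hlam : 0 < lam) (hμ : 0 < μ) :
    0 < ∑ k ∈ Finset.range (C + 1), (lam / μ) ^ k / (k ! : ℝ) :=
  Finset.sum_pos (fun k _ => by positivity) ⟨0, by simp⟩

theorem lossStationary_nonneg (hlam : 0 < lam) (hμ : 0 < μ) (i : Fin (C + 1)) :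
    0 ≤ lossStationary C lam μ i :=
  div_nonneg (by positivity) (erlang_partition_pos hlam hμ).le

theorem lossStationary_sum (hlam : 0 < lam) (hμ : 0 < μ) :
    ∑ i, lossStationary C lam μ i = 1 := by
  unfold lossStationary
  rw [← Finset.sum_div,
    Fin.sum_univ_eq_sum_range (fun i => (lam / μ) ^ (C - i) / ((C - i) ! : ℝ)),
    div_eq_one_iff_eq (erlang_partition_pos hlam hμ).ne']
  exact Finset.sum_range_reflect (fun k => (lam / μ) ^ k / (k ! : ℝ)) (C + 1) ▸
    Finset.sum_congr rfl fun i _ => by simp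

/-- With m busy threads the weight is ρ^m / m!, and consecutive weights have ratio ρ / (m + 1). -/
theorem lossStationary_balance (hμ : 0 < μ) {i j : Fin (C + 1)} (h : (j : ℕ) + 1 = i) :
    lossStationary C lam μ i * lam = lossStationary C lam μ j * (((C : ℝ) - (j : ℕ)) * μ) := by
  unfold lossStationary
  obtain ⟨m, hm⟩ : ∃ m, C - (j : ℕ) = m + 1 := ⟨C - j - 1, by omega⟩
  have hm' : C - (i : ℕ) = m := by omega
  have hc : (C : ℝ) - (j : ℕ) = m + 1 := by
    rw [← Nat.cast_sub (by omega), hm]; push_cast; ring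
  rw [hm, hm', hc, Nat.factorial_succ]
  push_cast
  have : (m ! : ℝ) ≠ 0 := by positivity
  rw [pow_succ]
  field_simp

/-- Birth-death chains are reversible: detailed balance turns the column sum at `j` into the weight
of `j` times a row sum of the generator, which is zero. -/
theorem lossStationary_vecMul_lossGenerator (hμ : 0 < μ) :
    Matrix.vecMul (lossStationary C lam μ) (lossGenerator C lam μ) = 0 := by
  have h : ∀ i j, lossStationary C lam μ i * lossGenerator C lam μ i j
      = lossStationary C lam μ j * lossGenerator C lam μ j i := by
    intro i j
    rw [lossGenerator_apply, lossGenerator_apply]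
    rcases eq_or_ne i j with rfl | hij
    · rfl
    by_cases h1 : (j : ℕ) + 1 = i
    · rw [if_pos h1, if_neg (by omega), if_pos h1.symm, lossStationary_balance hμ h1]
    by_cases h2 : (j : ℕ) = i + 1
    · rw [if_neg h1, if_pos h2, if_pos h2.symm, lossStationary_balance hμ h2.symm]
    rw [if_neg h1, if_neg h2, if_neg hij.symm, if_neg (Ne.symm h2), if_neg (Ne.symm h1),
      if_neg hij]
    simp
  funext j
  simp only [Matrix.vecMul, dotProduct, Pi.zero_apply]
  rw [Finset.sum_congr rfl fun i _ => h i j, ← Finset.mul_sum, lossGenerator_row_sum, mul_zero]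

/-- The indicator of the states with an idle thread. -/
def idleIndicator (x : Fin (C + 1)) : ℝ := if 0 < x then 1 else 0

theorem idleIndicator_nonneg (x : Fin (C + 1)) : 0 ≤ idleIndicator x := by
  unfold idleIndicator; split_ifs <;> norm_num

theorem idleIndicator_le_one (x : Fin (C + 1)) : idleIndicator x ≤ 1 := by
  unfold idleIndicator; split_ifs <;> norm_num

/-- State 0 means that all threads are busy, and its stationary mass is the Erlang-B blocking
probability. -/
theorem lossStationary_idle (hlam : 0 < lam) (hμ : 0 < μ) :
    ∑ i, lossStationary C lam μ i * idleIndicator i = pIdle lam μ C := by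
  have h0 : lossStationary C lam μ 0 = erlangB (lam / μ) C := by
    simp [lossStationary, erlangB]
  have h1 := lossStationary_sum (C := C) hlam hμ
  rw [Fin.sum_univ_succ] at h1 ⊢
  simp only [idleIndicator, lt_irrefl, if_false, mul_zero, zero_add, Fin.succ_pos, if_true,
    mul_one, pIdle]
  linarith

theorem lossGenerator_offDiag_nonneg (hlam : 0 < lam) (hμ : 0 < μ) {i j : Fin (C + 1)}
    (h : i ≠ j) : 0 ≤ lossGenerator C lam μ i j := by
  have hi : ((i : ℕ) : ℝ) ≤ C := by exact_mod_cast Nat.lt_succ_iff.1 i.2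
  rw [lossGenerator_apply, if_neg h.symm]
  split_ifs
  · exact hlam.le
  · exact mul_nonneg (by linarith) hμ.le
  · exact le_rfl

/-- The total jump rate out of any state is at most λ + Cμ, which serves as uniformization rate. -/
theorem lossGenerator_shift_nonneg (hlam : 0 < lam) (hμ : 0 < μ) (i j : Fin (C + 1)) :
    0 ≤ (lossGenerator C lam μ + (lam + C * μ) • (1 : Matrix (Fin (C + 1)) (Fin (C + 1)) ℝ)) i j := by
  rw [Matrix.add_apply, Matrix.smul_apply, Matrix.one_apply]
  rcases eq_or_ne i j with rfl | hij
  · have hi : 0 ≤ ((i : ℕ) : ℝ) * μ := by positivity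
    rw [lossGenerator_apply, if_neg (by omega), if_neg (by omega), if_pos rfl, if_pos rfl]
    split_ifs <;> simp only [smul_eq_mul] <;> nlinarith
  · simpa [hij] using lossGenerator_offDiag_nonneg hlam hμ hij

theorem lossGenerator_exp_nonneg (hlam : 0 < lam) (hμ : 0 < μ) {u : ℝ} (hu : 0 ≤ u)
    (i j : Fin (C + 1)) : 0 ≤ NormedSpace.exp (u • lossGenerator C lam μ) i j := by
  rw [matrix_exp_eq_shift _ (u * (lam + C * μ)), mul_smul, ← smul_add]
  refine mul_nonneg (Real.exp_pos _).le ?_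
  refine le_trans ?_ (matrix_exp_apply_ge (fun i j => ?_) 0 i j)
  · rw [pow_zero, Matrix.one_apply]; split_ifs <;> simp
  · exact mul_nonneg hu (lossGenerator_shift_nonneg hlam hμ i j)

theorem lossGenerator_exp_row_sum (u : ℝ) (i : Fin (C + 1)) :
    ∑ j, NormedSpace.exp (u • lossGenerator C lam μ) i j = 1 := by
  have h : (u • lossGenerator C lam μ).mulVec 1 = 0 := by
    funext i
    simp [Matrix.mulVec, dotProduct, ← Finset.mul_sum, lossGenerator_row_sum]
  have := congrFun (matrix_exp_mulVec_of_mulVec_eq_zero h) i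
  simpa [Matrix.mulVec, dotProduct] using this

/-- State 0 is reached from `i` by `i` downward jumps, each of rate λ > 0, so the `i`-th term of the
uniformized series is already positive. This is the Doeblin condition at time 1. -/
theorem lossGenerator_exp_col_pos (hlam : 0 < lam) (hμ : 0 < μ) (i : Fin (C + 1)) :
    0 < NormedSpace.exp ((1 : ℝ) • lossGenerator C lam μ) i 0 := by
  rw [one_smul, matrix_exp_eq_shift _ (lam + C * μ)]
  refine mul_pos (Real.exp_pos _) ?_
  set A := lossGenerator C lam μ + (lam + C * μ) • (1 : Matrix (Fin (C + 1)) (Fin (C + 1)) ℝ)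
    with hA
  have hnn : ∀ i j, 0 ≤ A i j := lossGenerator_shift_nonneg hlam hμ
  have key : ∀ k : ℕ, ∀ i : Fin (C + 1), (i : ℕ) = k → 0 < (A ^ k) i 0 := by
    intro k
    induction k with
    | zero =>
      intro i hi
      have : i = 0 := Fin.ext hi
      simp [this]
    | succ k ih =>
      intro i hi
      have hk : k < C + 1 := by have := i.2; omega
      rw [pow_succ', Matrix.mul_apply]
      refine lt_of_lt_of_le ?_ (Finset.single_le_sum
        (f := fun j => A i j * (A ^ k) j 0)
        (fun j _ => mul_nonneg (hnn i j) (matrix_pow_apply_nonneg hnn k j 0))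
        (Finset.mem_univ (⟨k, hk⟩ : Fin (C + 1))))
      refine mul_pos ?_ (ih _ rfl)
      have hne : i ≠ ⟨k, hk⟩ := fun h => by rw [h] at hi; simp at hi
      rw [hA, Matrix.add_apply, Matrix.smul_apply, Matrix.one_apply_ne hne, lossGenerator_apply,
        if_pos hi.symm]
      simpa using hlam
  exact lt_of_lt_of_le (mul_pos (by positivity) (key _ i rfl)) (matrix_exp_apply_ge hnn (i : ℕ) i 0)

/-- Exponential ergodicity of the Erlang loss system. -/
theorem lossGenerator_exp_decay (hlam : 0 < lam) (hμ : 0 < μ) :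
    ∃ γ K : ℝ, 0 < γ ∧ 0 ≤ K ∧ ∀ u : ℝ, 0 ≤ u → ∀ x : Fin (C + 1),
      |∑ y, NormedSpace.exp (u • lossGenerator C lam μ) x y * idleIndicator y - pIdle lam μ C|
        ≤ K * Real.exp (-γ * u) := by
  set Q := lossGenerator C lam μ with hQ
  -- The cap 1/2 keeps 1 - δ positive, so that its logarithm gives a finite decay rate.
  obtain ⟨δ, hδ0, hδ1, hδ⟩ : ∃ δ : ℝ, 0 < δ ∧ δ ≤ 1 / 2 ∧
      ∀ i, δ ≤ NormedSpace.exp ((1 : ℝ) • Q) i 0 := by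
    obtain ⟨i0, hi0⟩ := Finite.exists_min fun i => NormedSpace.exp ((1 : ℝ) • Q) i 0
    exact ⟨min (1 / 2) (NormedSpace.exp ((1 : ℝ) • Q) i0 0),
      lt_min (by norm_num) (lossGenerator_exp_col_pos hlam hμ i0), min_le_left _ _,
      fun i => (min_le_right _ _).trans (hi0 i)⟩
  have hw : ∀ u : ℝ, Matrix.vecMul (lossStationary C lam μ) (NormedSpace.exp (u • Q))
      = lossStationary C lam μ := fun u =>
    matrix_vecMul_exp_of_vecMul_eq_zero (by
      rw [Matrix.vecMul_smul, lossStationary_vecMul_lossGenerator hμ, smul_zero])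
  have hlog : Real.log (1 - δ) < 0 := Real.log_neg (by linarith) (by linarith)
  -- Only the ⌊u⌋ > u - 1 whole time units contract; the constant K = exp γ pays for the lost
  -- fraction. The fractional time is absorbed in the test vector `v`, which keeps values in [0, 1]
  -- and the same stationary mean.
  refine ⟨-Real.log (1 - δ), Real.exp (-Real.log (1 - δ)), by linarith, (Real.exp_pos _).le,
    fun u hu x => ?_⟩
  set k := ⌊u⌋₊ with hk
  have hk1 : (k : ℝ) ≤ u := Nat.floor_le hu
  have hk2 : u < k + 1 := Nat.lt_floor_add_one u
  have huk : 0 ≤ u - k := by linarith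
  set v := (NormedSpace.exp ((u - k) • Q)).mulVec idleIndicator with hv
  have hexp : NormedSpace.exp (u • Q)
      = NormedSpace.exp ((1 : ℝ) • Q) ^ k * NormedSpace.exp ((u - k) • Q) := by
    rw [← Matrix.exp_nsmul, one_smul, ← Matrix.exp_add_of_commute]
    · congr 1
      rw [← Nat.cast_smul_eq_nsmul ℝ, ← add_smul]
      congr 1; ring
    · rw [← Nat.cast_smul_eq_nsmul ℝ]
      exact ((Commute.refl Q).smul_right _).smul_left _
  have hv0 : ∀ i, 0 ≤ v i := fun i => by
    change 0 ≤ ∑ j, NormedSpace.exp ((u - k) • Q) i j * idleIndicator j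
    exact Finset.sum_nonneg fun j _ =>
    mul_nonneg (lossGenerator_exp_nonneg hlam hμ huk i j) (idleIndicator_nonneg j)
  have hv1 : ∀ i, v i ≤ 1 := fun i => by
    rw [← lossGenerator_exp_row_sum (C := C) (lam := lam) (μ := μ) (u - k) i]
    change ∑ j, NormedSpace.exp ((u - k) • Q) i j * idleIndicator j ≤ _
    exact Finset.sum_le_sum fun j _ => mul_le_of_le_one_right
      (lossGenerator_exp_nonneg hlam hμ huk i j) (idleIndicator_le_one j)
  have hmean : ∑ j, lossStationary C lam μ j * v j = pIdle lam μ C := by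
    have := Matrix.dotProduct_mulVec (lossStationary C lam μ) (NormedSpace.exp ((u - k) • Q))
      idleIndicator
    rw [hw] at this
    rw [← lossStationary_idle hlam hμ]
    exact this
  have main := abs_matrix_pow_mulVec_sub_le (A := NormedSpace.exp ((1 : ℝ) • Q))
    (lossGenerator_exp_nonneg hlam hμ zero_le_one) (lossGenerator_exp_row_sum 1) hδ
    (lossStationary_nonneg hlam hμ) (lossStationary_sum hlam hμ) (hw 1) v hv0 hv1 k x
  rw [hmean, hv, Matrix.mulVec_mulVec, ← hexp] at main
  refine le_trans main ?_
  rw [← Real.exp_log (show 0 < 1 - δ by linarith), ← Real.exp_nat_mul, Real.log_exp,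
    ← Real.exp_add]
  exact Real.exp_le_exp.2 (by nlinarith)

end LossSystem

/-! ### Grid approximation of times -/

section Grid

/-- The largest multiple of `1 / (m + 1)` strictly below `s` (and `0` for `s = 0`). -/
noncomputable def gridBelow (m : ℕ) (s : ℝ≥0) : ℝ≥0 := ((⌈(m + 1) * s⌉₊ - 1 : ℕ) : ℝ≥0) / (m + 1)

/-- The smallest multiple of `1 / (m + 1)` that is at least `s`. -/
noncomputable def gridAbove (m : ℕ) (s : ℝ≥0) : ℝ≥0 := (⌈(m + 1) * s⌉₊ : ℝ≥0) / (m + 1)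

theorem tendsto_one_div_add_one_nnreal :
    Tendsto (fun m : ℕ => (1 : ℝ≥0) / (m + 1)) atTop (𝓝 0) := by
  rw [← NNReal.tendsto_coe]
  simpa using tendsto_one_div_add_atTop_nhds_zero_nat (𝕜 := ℝ)

theorem gridBelow_mono (m : ℕ) : Monotone (gridBelow m) := by
  intro s t h
  unfold gridBelow
  gcongr

theorem gridBelow_zero (m : ℕ) : gridBelow m 0 = 0 := by simp [gridBelow]

theorem gridBelow_lt (m : ℕ) {s : ℝ≥0} (hs : 0 < s) : gridBelow m s < s := by
  unfold gridBelow
  have hc : 0 < ⌈((m : ℝ≥0) + 1) * s⌉₊ := Nat.ceil_pos.2 (by positivity)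
  rw [div_lt_iff₀ (by positivity), mul_comm s]
  exact Nat.lt_ceil.1 (by omega)

theorem le_gridBelow_add (m : ℕ) (s : ℝ≥0) : s ≤ gridBelow m s + 1 / (m + 1) := by
  unfold gridBelow
  rw [← add_div, le_div_iff₀ (by positivity), mul_comm s]
  refine (Nat.le_ceil _).trans ?_
  norm_cast
  omega

theorem tendsto_gridBelow (s : ℝ≥0) : Tendsto (fun m => gridBelow m s) atTop (𝓝 s) := by
  have h1 : Tendsto (fun m : ℕ => s - (1 : ℝ≥0) / (m + 1)) atTop (𝓝 s) := by
    simpa using (tendsto_const_nhds (x := s)).sub tendsto_one_div_add_one_nnreal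
  refine tendsto_of_tendsto_of_tendsto_of_le_of_le h1 tendsto_const_nhds
    (fun m => tsub_le_iff_right.2 (le_gridBelow_add m s)) (fun m => ?_)
  rcases eq_or_ne s 0 with rfl | hs
  · exact (gridBelow_zero m).le
  · exact (gridBelow_lt m (pos_iff_ne_zero.2 hs)).le

theorem le_gridAbove (m : ℕ) (s : ℝ≥0) : s ≤ gridAbove m s := by
  unfold gridAbove
  rw [le_div_iff₀ (by positivity), mul_comm s]
  exact Nat.le_ceil _

theorem gridAbove_le (m : ℕ) (s : ℝ≥0) : gridAbove m s ≤ s + 1 / (m + 1) := by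
  unfold gridAbove
  rw [div_le_iff₀ (by positivity), add_mul s, div_mul_cancel₀ _ (by positivity), mul_comm s]
  exact (Nat.ceil_lt_add_one (by positivity)).le

theorem tendsto_gridAbove (s : ℝ≥0) : Tendsto (fun m => gridAbove m s) atTop (𝓝 s) := by
  have h1 : Tendsto (fun m : ℕ => s + (1 : ℝ≥0) / (m + 1)) atTop (𝓝 s) := by
    simpa using (tendsto_const_nhds (x := s)).add tendsto_one_div_add_one_nnreal
  exact tendsto_of_tendsto_of_tendsto_of_le_of_le tendsto_const_nhds h1
    (fun m => le_gridAbove m s) (fun m => gridAbove_le m s)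

/-- The grid points approach `s` strictly from below, and a convergent sequence in a discrete space
is eventually constant. At `s = 0` truncated subtraction keeps the grid point at 0, in agreement
with the convention for the left limit there. -/
theorem eventually_gridBelow_eq_leftLim {E : Type*} [TopologicalSpace E] [DiscreteTopology E]
    {f : ℝ≥0 → E} (hf : HasCadlagPaths f) (s : ℝ≥0) :
    ∀ᶠ m in atTop, f (gridBelow m s) = Function.leftLim f s := by
  rcases eq_or_ne s 0 with rfl | hs
  · have : Function.leftLim f 0 = f 0 := leftLim_eq_of_isBot (fun a => zero_le)
    simp [gridBelow_zero, this]
  · have hs' : 0 < s := pos_iff_ne_zero.2 hs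
    have h1 : Tendsto (fun m => gridBelow m s) atTop (𝓝[<] s) :=
      tendsto_nhdsWithin_iff.2 ⟨tendsto_gridBelow s, .of_forall fun m => gridBelow_lt m hs'⟩
    have hne : (𝓝[<] s).NeBot := h1.neBot
    obtain ⟨l, hl⟩ := (hf s).2
    rw [leftLim_eq_of_tendsto hl]
    have h2 := hl.comp h1
    rw [nhds_discrete, tendsto_pure] at h2
    exact h2

end Grid

/-! ### Sampling at independent random times -/

section Sampling

variable {Ω : Type*} [MeasurableSpace Ω] {P : Measure Ω} [IsProbabilityMeasure P]

/-- Evaluation of an arbitrary path at a variable time is not measurable for the product σ-algebra;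
restricting the time to countably many values makes it so. -/
theorem measurable_path_apply_comp_nat {E α : Type*} [MeasurableSpace E] [MeasurableSpace α]
    (a : ℕ → ℝ≥0) {j : α → ℕ} (hj : Measurable j) :
    Measurable fun p : (ℝ≥0 → E) × α => p.1 (a (j p.2)) := by
  have h : Measurable fun p : (ℝ≥0 → E) × ℕ => p.1 (a p.2) :=
    measurable_from_prod_countable_left fun n => measurable_pi_apply (a n)
  exact h.comp (measurable_fst.prodMk (hj.comp measurable_snd))

/-- Sampling a process with constant one-dimensional laws at an independent random time with
countably many values. -/
theorem measure_independent_sample {E : Type*} [MeasurableSpace E] {Z : ℝ≥0 → Ω → E}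
    (hZ : ∀ t, Measurable (Z t)) {α : Type*} [MeasurableSpace α] {T : Ω → α} (hT : Measurable T)
    (hind : IndepFun (fun ω t => Z t ω) T P) (a : ℕ → ℝ≥0) {j : α → ℕ} (hj : Measurable j)
    {A : Set E} (hA : MeasurableSet A) {q : ℝ≥0∞} (hq : ∀ t, P {ω | Z t ω ∈ A} = q) :
    P {ω | Z (a (j (T ω))) ω ∈ A} = q := by
  have hZ' : Measurable fun ω t => Z t ω := measurable_pi_lambda _ hZ
  have hB : MeasurableSet {p : (ℝ≥0 → E) × α | p.1 (a (j p.2)) ∈ A} :=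
    measurable_path_apply_comp_nat a hj hA
  have h1 : P {ω | Z (a (j (T ω))) ω ∈ A}
      = P.map (fun ω => ((fun t => Z t ω), T ω)) {p | p.1 (a (j p.2)) ∈ A} := by
    rw [Measure.map_apply (hZ'.prodMk hT) hB]; rfl
  have : IsProbabilityMeasure (P.map T) := Measure.isProbabilityMeasure_map hT.aemeasurable
  have : IsProbabilityMeasure (P.map fun ω t => Z t ω) :=
    Measure.isProbabilityMeasure_map hZ'.aemeasurable
  rw [h1, hind.map_prod_eq_prod_map_map hZ'.aemeasurable hT.aemeasurable,
    Measure.prod_apply_symm hB]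
  have h2 : ∀ x : α, (P.map fun ω t => Z t ω)
      ((fun y => (y, x)) ⁻¹' {p : (ℝ≥0 → E) × α | p.1 (a (j p.2)) ∈ A}) = q := by
    intro x
    rw [Measure.map_apply hZ' (measurable_prodMk_right hB), ← hq (a (j x))]
    rfl
  rw [lintegral_congr h2, lintegral_const, measure_univ, mul_one]

theorem measure_eq_of_ae_eventually {S : ℕ → Set Ω} (hS : ∀ m, MeasurableSet (S m)) {B : Set Ω}
    {q : ℝ≥0∞} (hq : ∀ m, P (S m) = q) (h : ∀ᵐ ω ∂P, ∀ᶠ m in atTop, ω ∈ S m ↔ ω ∈ B) :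
    P B = q := by
  -- `B` need not be measurable; the set-theoretic liminf of the `S m` is, and it agrees with `B`
  -- almost surely.
  set B' : Set Ω := ⋃ n, ⋂ m ≥ n, S m with hB'
  have hmeas : MeasurableSet B' :=
    MeasurableSet.iUnion fun n => MeasurableSet.iInter fun m => MeasurableSet.iInter fun _ => hS m
  have hmem : ∀ ω, ω ∈ B' ↔ ∀ᶠ m in atTop, ω ∈ S m := fun ω => by
    simp [hB', eventually_atTop]
  have hae : B =ᵐ[P] B' := by
    filter_upwards [h] with ω hω
    refine propext ?_
    change ω ∈ B ↔ ω ∈ B'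
    rw [hmem, eventually_congr hω, eventually_const]
  rw [measure_congr hae]
  refine tendsto_nhds_unique (tendsto_measure_of_ae_tendsto_indicator_of_isFiniteMeasure
    (μ := P) (L := atTop) hmeas hS ?_) ?_
  · filter_upwards [h, hae] with ω hω h2
    have h2' : ω ∈ B ↔ ω ∈ B' := Iff.of_eq h2
    filter_upwards [hω] with m hm
    rw [hm, h2']
  · simp [hq]

/-- One-sided path regularity lets countable grids replace the random time, since the sampled value
stabilises under refinement. It serves for left limits at update times and for right limits at task
arrivals. -/
theorem measure_independent_sample_of_eventually {E : Type*} [MeasurableSpace E]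
    {Z : ℝ≥0 → Ω → E} (hZ : ∀ t, Measurable (Z t)) {T : Ω → ℝ≥0} (hT : Measurable T)
    (hind : IndepFun (fun ω t => Z t ω) T P) (a : ℕ → ℕ → ℝ≥0) {j : ℕ → ℝ≥0 → ℕ}
    (hj : ∀ m, Measurable (j m)) {A : Set E} (hA : MeasurableSet A) {q : ℝ≥0∞}
    (hq : ∀ t, P {ω | Z t ω ∈ A} = q) {W : Ω → E}
    (hW : ∀ᵐ ω ∂P, ∀ᶠ m in atTop, Z (a m (j m (T ω))) ω = W ω) :
    P {ω | W ω ∈ A} = q := by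
  refine measure_eq_of_ae_eventually (S := fun m => {ω | Z (a m (j m (T ω))) ω ∈ A})
    (fun m => ?_) (fun m => measure_independent_sample hZ hT hind (a m) (hj m) hA hq) ?_
  · have hZ' : Measurable fun ω t => Z t ω := measurable_pi_lambda _ hZ
    exact (measurable_path_apply_comp_nat (a m) (hj m)).comp (hZ'.prodMk hT) hA
  · filter_upwards [hW] with ω hω
    filter_upwards [hω] with m hm
    simp [hm]

/-- By Tonelli the sum has finite expectation. Applied to squares of normalised sums, it does the
work of Chebyshev and Borel–Cantelli. -/
theorem ae_summable_of_summable_integral {V : ℕ → Ω → ℝ} (h0 : ∀ m ω, 0 ≤ V m ω)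
    (hint : ∀ m, Integrable (V m) P) (hsum : Summable fun m => ∫ ω, V m ω ∂P) :
    ∀ᵐ ω ∂P, Summable fun m => V m ω := by
  have h1 : ∑' m, ∫⁻ ω, ENNReal.ofReal (V m ω) ∂P ≠ ∞ := by
    have : ∀ m, ∫⁻ ω, ENNReal.ofReal (V m ω) ∂P = ENNReal.ofReal (∫ ω, V m ω ∂P) := fun m =>
      (ofReal_integral_eq_lintegral_ofReal (hint m) (.of_forall (h0 m))).symm
    simp_rw [this]
    exact hsum.tsum_ofReal_ne_top
  rw [← lintegral_tsum fun m => (hint m).aemeasurable.ennreal_ofReal] at h1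
  have h2 := ae_lt_top' (AEMeasurable.tsum fun m =>
    (hint m).aemeasurable.ennreal_ofReal) h1
  filter_upwards [h2] with ω hω
  have := ENNReal.summable_toReal hω.ne
  simpa [ENNReal.toReal_ofReal (h0 _ ω)] using this

end Sampling

/-! ### Covariance decay of the idle indicators -/

section MarkovCovariance

variable {Ω : Type*} [MeasurableSpace Ω] {P : Measure Ω} [IsProbabilityMeasure P]
  {C : ℕ} {lam μ : ℝ} {c : ℝ≥0 → Ω → Fin (C + 1)}

theorem IsErlangLossSystem.measureReal_pair (hc : IsErlangLossSystem C lam μ c P) {s t : ℝ≥0}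
    (hst : s ≤ t) (x y : Fin (C + 1)) :
    P.real {ω | c s ω = x ∧ c t ω = y} = P.real {ω | c s ω = x} *
      NormedSpace.exp (((t : ℝ) - s) • lossGenerator C lam μ) x y := by
  have h := hc.markov 1 (fun i => if i = 0 then s else t)
    (fun i j hij => by
      dsimp only
      split_ifs <;> first | exact le_rfl | exact hst | omega)
    (fun i => if i = 0 then x else y)
  have hs : {ω | ∀ i ≤ 1, c (if i = 0 then s else t) ω = if i = 0 then x else y}
      = {ω | c s ω = x ∧ c t ω = y} := by
    ext ω
    constructor
    · intro h
      exact ⟨by simpa using h 0 (by norm_num), by simpa using h 1 le_rfl⟩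
    · rintro ⟨h0, h1⟩ i hi
      interval_cases i <;> simp [h0, h1]
  rw [hs] at h
  simpa using h

theorem IsErlangLossSystem.sum_measureReal (hc : IsErlangLossSystem C lam μ c P) (s : ℝ≥0) :
    ∑ x, P.real {ω | c s ω = x} = 1 := by
  have : IsProbabilityMeasure (P.map (c s)) :=
    Measure.isProbabilityMeasure_map (hc.measurable s).aemeasurable
  have h := integral_fintype (μ := P.map (c s)) (f := fun _ => (1 : ℝ)) Integrable.of_finite
  simp only [integral_const, smul_eq_mul, mul_one, probReal_univ] at h
  rw [h]
  refine Finset.sum_congr rfl fun x _ => ?_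
  rw [map_measureReal_apply (hc.measurable s) (measurableSet_singleton x)]
  rfl

theorem IsErlangLossSystem.integral_pair (hc : IsErlangLossSystem C lam μ c P) {s t : ℝ≥0}
    (hst : s ≤ t) (f g : Fin (C + 1) → ℝ) :
    ∫ ω, f (c s ω) * g (c t ω) ∂P = ∑ x, P.real {ω | c s ω = x} * (f x *
      ∑ y, NormedSpace.exp (((t : ℝ) - s) • lossGenerator C lam μ) x y * g y) := by
  have hm : Measurable fun ω => (c s ω, c t ω) := (hc.measurable s).prodMk (hc.measurable t)
  have : IsProbabilityMeasure (P.map fun ω => (c s ω, c t ω)) :=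
    Measure.isProbabilityMeasure_map hm.aemeasurable
  have h1 : ∫ ω, f (c s ω) * g (c t ω) ∂P
      = ∫ z, f z.1 * g z.2 ∂(P.map fun ω => (c s ω, c t ω)) := by
    rw [integral_map hm.aemeasurable (measurable_of_finite _).aestronglyMeasurable]
  rw [h1, integral_fintype Integrable.of_finite, Fintype.sum_prod_type]
  refine Finset.sum_congr rfl fun x _ => ?_
  rw [Finset.mul_sum, Finset.mul_sum]
  refine Finset.sum_congr rfl fun y _ => ?_
  rw [map_measureReal_apply hm (measurableSet_singleton _)]
  have : (fun ω => (c s ω, c t ω)) ⁻¹' {(x, y)} = {ω | c s ω = x ∧ c t ω = y} := by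
    ext ω; simp
  rw [this, hc.measureReal_pair hst, smul_eq_mul]
  ring

theorem measurable_idleIndicator : Measurable (idleIndicator (C := C)) := measurable_of_finite _

theorem pIdle_nonneg (hlam : 0 < lam) (hμ : 0 < μ) : 0 ≤ pIdle lam μ C := by
  rw [← lossStationary_idle hlam hμ]
  exact Finset.sum_nonneg fun i _ =>
    mul_nonneg (lossStationary_nonneg hlam hμ i) (idleIndicator_nonneg i)

theorem abs_idleIndicator_sub_le (hlam : 0 < lam) (hμ : 0 < μ) (x : Fin (C + 1)) :
    |idleIndicator x - pIdle lam μ C| ≤ 1 := by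
  have h0 : 0 ≤ pIdle lam μ C := pIdle_nonneg hlam hμ
  have h1 : pIdle lam μ C ≤ 1 := by
    rw [← lossStationary_idle hlam hμ, ← lossStationary_sum (C := C) hlam hμ]
    exact Finset.sum_le_sum fun i _ =>
      mul_le_of_le_one_right (lossStationary_nonneg hlam hμ i) (idleIndicator_le_one i)
  rw [abs_le]
  constructor <;> linarith [idleIndicator_nonneg x, idleIndicator_le_one x]

/-- Given the state at time `s`, the later centred indicator has conditional mean of size K exp(-γ(t
- s)), and the earlier factor is at most 1. Centring at the stationary value, not at the mean, makes
the initial law irrelevant. -/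
theorem IsErlangLossSystem.exists_covariance_bound (hc : IsErlangLossSystem C lam μ c P)
    (hlam : 0 < lam) (hμ : 0 < μ) :
    ∃ γ K : ℝ, 0 < γ ∧ 0 ≤ K ∧ ∀ s t : ℝ≥0, s ≤ t →
      ∫ ω, (idleIndicator (c s ω) - pIdle lam μ C) * (idleIndicator (c t ω) - pIdle lam μ C) ∂P
        ≤ K * Real.exp (-γ * ((t : ℝ) - s)) := by
  obtain ⟨γ, K, hγ, hK, h⟩ := lossGenerator_exp_decay (C := C) hlam hμ
  refine ⟨γ, K, hγ, hK, fun s t hst => ?_⟩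
  rw [hc.integral_pair hst (fun x => idleIndicator x - pIdle lam μ C)
    (fun x => idleIndicator x - pIdle lam μ C)]
  have hu : 0 ≤ (t : ℝ) - s := sub_nonneg.2 hst
  have hd := h _ hu
  set e := K * Real.exp (-γ * ((t : ℝ) - s))
  calc _ ≤ ∑ x, P.real {ω | c s ω = x} * e := by
        refine Finset.sum_le_sum fun x _ => mul_le_mul_of_nonneg_left ?_ measureReal_nonneg
        refine (le_abs_self _).trans ?_
        rw [abs_mul]
        have h2 : ∑ y, NormedSpace.exp (((t : ℝ) - s) • lossGenerator C lam μ) x y *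
            (idleIndicator y - pIdle lam μ C)
            = ∑ y, NormedSpace.exp (((t : ℝ) - s) • lossGenerator C lam μ) x y * idleIndicator y
              - pIdle lam μ C := by
          simp only [mul_sub, Finset.sum_sub_distrib, ← Finset.sum_mul,
            lossGenerator_exp_row_sum, one_mul]
        rw [h2]
        calc _ ≤ 1 * e := mul_le_mul (abs_idleIndicator_sub_le hlam hμ x) (hd x) (abs_nonneg _)
              zero_le_one
          _ = e := one_mul e
    _ = e := by rw [← Finset.sum_mul, hc.sum_measureReal, one_mul]

/-- Updates report left limits, so the bound is carried over by dominated convergence along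
`gridBelow`, whose monotonicity preserves `s ≤ t` at every mesh. -/
theorem IsErlangLossSystem.leftLim_covariance_bound (hc : IsErlangLossSystem C lam μ c P)
    (hlam : 0 < lam) (hμ : 0 < μ) :
    ∃ γ K : ℝ, 0 < γ ∧ 0 ≤ K ∧ ∀ s t : ℝ≥0, s ≤ t →
      ∫ ω, (idleIndicator (Function.leftLim (fun u => c u ω) s) - pIdle lam μ C) *
        (idleIndicator (Function.leftLim (fun u => c u ω) t) - pIdle lam μ C) ∂P
        ≤ K * Real.exp (-γ * ((t : ℝ) - s)) := by
  obtain ⟨γ, K, hγ, hK, h⟩ := hc.exists_covariance_bound hlam hμ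
  refine ⟨γ, K, hγ, hK, fun s t hst => ?_⟩
  have hlim : Tendsto (fun m : ℕ => ∫ ω, (idleIndicator (c (gridBelow m s) ω) - pIdle lam μ C) *
      (idleIndicator (c (gridBelow m t) ω) - pIdle lam μ C) ∂P) atTop
      (𝓝 (∫ ω, (idleIndicator (Function.leftLim (fun u => c u ω) s) - pIdle lam μ C) *
        (idleIndicator (Function.leftLim (fun u => c u ω) t) - pIdle lam μ C) ∂P)) := by
    refine tendsto_integral_of_dominated_convergence (fun _ => 1) (fun m => ?_)
      (integrable_const _) (fun m => .of_forall fun ω => ?_) (.of_forall fun ω => ?_)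
    · exact (((measurable_idleIndicator.comp (hc.measurable _)).sub_const _).mul
        ((measurable_idleIndicator.comp (hc.measurable _)).sub_const _)).aestronglyMeasurable
    · rw [norm_mul]
      exact mul_le_one₀ (abs_idleIndicator_sub_le hlam hμ _) (norm_nonneg _)
        (abs_idleIndicator_sub_le hlam hμ _)
    · refine tendsto_const_nhds.congr' ?_
      filter_upwards [eventually_gridBelow_eq_leftLim (hc.cadlag ω) s,
        eventually_gridBelow_eq_leftLim (hc.cadlag ω) t] with m h1 h2
      rw [← h1, ← h2]
  have hlim2 : Tendsto (fun m : ℕ => K * Real.exp (-γ * ((gridBelow m t : ℝ) - gridBelow m s)))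
      atTop (𝓝 (K * Real.exp (-γ * ((t : ℝ) - s)))) := by
    refine Tendsto.const_mul _ ((Real.continuous_exp.tendsto _).comp (Tendsto.const_mul _ ?_))
    exact (NNReal.tendsto_coe.2 (tendsto_gridBelow t)).sub
      (NNReal.tendsto_coe.2 (tendsto_gridBelow s))
  exact le_of_tendsto_of_tendsto' hlim hlim2 fun m => h _ _ (gridBelow_mono m hst)

theorem IsErlangLossSystem.measurable_leftLim_idle (hc : IsErlangLossSystem C lam μ c P)
    (s : ℝ≥0) : Measurable fun ω => Function.leftLim (fun u => c u ω) s := by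
  refine measurable_of_tendsto_metrizable (fun m => hc.measurable (gridBelow m s)) ?_
  rw [tendsto_pi_nhds]
  intro ω
  refine tendsto_const_nhds.congr' ?_
  filter_upwards [eventually_gridBelow_eq_leftLim (hc.cadlag ω) s] with m h1
  rw [← h1]

/-- The idle probability is constant in time by stationarity and tends to `pIdle` by ergodicity, so
the initial law never has to be identified. -/
theorem IsErlangLossSystem.measureReal_idle_of_inSteadyState
    (hc : IsErlangLossSystem C lam μ c P) (hlam : 0 < lam) (hμ : 0 < μ)
    (hs : InSteadyState c P) (t : ℝ≥0) : P.real {ω | 0 < c t ω} = pIdle lam μ C := by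
  obtain ⟨γ, K, hγ, hK, h⟩ := lossGenerator_exp_decay (C := C) hlam hμ
  have hset : MeasurableSet {x : Fin (C + 1) | 0 < x} := (Set.toFinite _).measurableSet
  have e1 : ∀ u, P.real {ω | 0 < c u ω} = ∫ ω, idleIndicator (c u ω) ∂P := by
    intro u
    have h1 := integral_indicator_one (μ := P) (hc.measurable u hset)
    have h2 : (fun ω => idleIndicator (c u ω)) = (c u ⁻¹' {x | 0 < x}).indicator 1 := by
      funext ω
      simp [idleIndicator, Set.indicator_apply]
    rw [h2, h1]
    rfl
  have e2 : ∀ u, P.real {ω | 0 < c u ω} = P.real {ω | 0 < c 0 ω} := by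
    intro u
    have := hs u
    have h1 := map_measureReal_apply (μ := P) (hc.measurable u) hset
    rw [this, map_measureReal_apply (hc.measurable 0) hset] at h1
    exact h1.symm
  have e3 : ∀ u : ℝ≥0, |P.real {ω | 0 < c 0 ω} - pIdle lam μ C| ≤ K * Real.exp (-γ * u) := by
    intro u
    rw [← e2 u, e1]
    have h1 := hc.integral_pair (zero_le (a := u)) (fun _ => 1) idleIndicator
    simp only [one_mul, NNReal.coe_zero, sub_zero] at h1
    rw [h1]
    have h2 : ∑ x, P.real {ω | c 0 ω = x} * pIdle lam μ C = pIdle lam μ C := by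
      rw [← Finset.sum_mul, hc.sum_measureReal, one_mul]
    rw [← h2, ← Finset.sum_sub_distrib]
    refine (Finset.abs_sum_le_sum_abs _ _).trans ?_
    calc _ ≤ ∑ x, P.real {ω | c 0 ω = x} * (K * Real.exp (-γ * u)) := by
          refine Finset.sum_le_sum fun x _ => ?_
          rw [← mul_sub, abs_mul, abs_of_nonneg measureReal_nonneg]
          exact mul_le_mul_of_nonneg_left (h u u.2 x) measureReal_nonneg
      _ = _ := by rw [← Finset.sum_mul, hc.sum_measureReal, one_mul]
  have e4 : Tendsto (fun u : ℝ≥0 => K * Real.exp (-γ * u)) atTop (𝓝 (K * 0)) := by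
    refine Tendsto.const_mul _ (Real.tendsto_exp_atBot.comp ?_)
    exact (tendsto_const_mul_atBot_of_neg (by linarith)).2 (NNReal.tendsto_coe_atTop.2 tendsto_id)
  have e5 : |P.real {ω | 0 < c 0 ω} - pIdle lam μ C| ≤ 0 := by
    rw [mul_zero] at e4
    exact ge_of_tendsto' e4 e3
  rw [e2, ← sub_eq_zero]
  exact abs_nonpos_iff.1 e5

end MarkovCovariance

/-! ### Strong law for gap-weighted sums at deterministic times -/

section WeightedSums

/-- After exchanging the sums, `a k` is multiplied by the sum of 1/⌊c^m⌋² over ⌊c^m⌋ > k, a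
geometric tail of order 1/(k+1)². -/
theorem summable_sum_div_floor_pow_sq {a : ℕ → ℝ} (ha : ∀ k, 0 ≤ a k)
    (hs : Summable fun k => a k / ((k : ℝ) + 1) ^ 2) {c : ℝ} (hc : 1 < c) :
    Summable fun m : ℕ => (∑ k ∈ Finset.range ⌊c ^ m⌋₊, a k) / (⌊c ^ m⌋₊ : ℝ) ^ 2 := by
  set D := c ^ 5 * (c - 1)⁻¹ ^ 3 with hD
  have hD0 : 0 ≤ D := by
    have : 0 < c - 1 := by linarith
    positivity
  refine summable_of_sum_range_le (c := 4 * D * ∑' k, a k / ((k : ℝ) + 1) ^ 2)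
    (fun m => div_nonneg (Finset.sum_nonneg fun k _ => ha k) (by positivity)) fun N => ?_
  have hmono : ∀ m ∈ Finset.range N, ⌊c ^ m⌋₊ ≤ ⌊c ^ N⌋₊ := fun m hm =>
    Nat.floor_le_floor (pow_le_pow_right₀ hc.le (Finset.mem_range.1 hm).le)
  calc ∑ m ∈ Finset.range N, (∑ k ∈ Finset.range ⌊c ^ m⌋₊, a k) / (⌊c ^ m⌋₊ : ℝ) ^ 2
      = ∑ m ∈ Finset.range N, ∑ k ∈ Finset.range ⌊c ^ N⌋₊,
          a k * (if k < ⌊c ^ m⌋₊ then 1 / (⌊c ^ m⌋₊ : ℝ) ^ 2 else 0) := by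
        refine Finset.sum_congr rfl fun m hm => ?_
        have : Finset.range ⌊c ^ m⌋₊ = (Finset.range ⌊c ^ N⌋₊).filter (· < ⌊c ^ m⌋₊) := by
          ext k
          have := hmono m hm
          simp only [Finset.mem_range, Finset.mem_filter]
          omega
        rw [this, Finset.sum_div, Finset.sum_filter]
        refine Finset.sum_congr rfl fun k _ => ?_
        split_ifs <;> ring
    _ = ∑ k ∈ Finset.range ⌊c ^ N⌋₊, a k *
          ∑ m ∈ Finset.range N with ((k : ℝ) + 1 / 2) < ⌊c ^ m⌋₊,
            (1 : ℝ) / (⌊c ^ m⌋₊ : ℝ) ^ 2 := by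
        rw [Finset.sum_comm]
        refine Finset.sum_congr rfl fun k _ => ?_
        rw [← Finset.mul_sum, Finset.sum_filter]
        congr 1
        refine Finset.sum_congr rfl fun m _ => ?_
        -- The tail estimate needs a positive threshold, which k = 0 is not; the half-integer shift
        -- costs the factor 4.
        have : k < ⌊c ^ m⌋₊ ↔ ((k : ℝ) + 1 / 2) < ⌊c ^ m⌋₊ := by
          constructor
          · intro h
            have : (k : ℝ) + 1 ≤ ⌊c ^ m⌋₊ := by exact_mod_cast h
            linarith
          · intro h
            have : (k : ℝ) < ⌊c ^ m⌋₊ := by linarith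
            exact_mod_cast this
        simp only [this]
    _ ≤ ∑ k ∈ Finset.range ⌊c ^ N⌋₊, 4 * D * (a k / ((k : ℝ) + 1) ^ 2) := by
        refine Finset.sum_le_sum fun k _ => ?_
        have h1 := sum_div_nat_floor_pow_sq_le_div_sq N (j := (k : ℝ) + 1 / 2) (by positivity) hc
        refine (mul_le_mul_of_nonneg_left h1 (ha k)).trans ?_
        have h2 : D / ((k : ℝ) + 1 / 2) ^ 2 ≤ 4 * D / ((k : ℝ) + 1) ^ 2 := by
          rw [div_le_div_iff₀ (by positivity) (by positivity)]
          have hk : (0 : ℝ) ≤ k := k.cast_nonneg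
          have : ((k : ℝ) + 1) ^ 2 ≤ 4 * ((k : ℝ) + 1 / 2) ^ 2 := by nlinarith
          nlinarith
        calc _ ≤ a k * (4 * D / ((k : ℝ) + 1) ^ 2) := mul_le_mul_of_nonneg_left h2 (ha k)
          _ = _ := by ring
    _ = 4 * D * ∑ k ∈ Finset.range ⌊c ^ N⌋₊, a k / ((k : ℝ) + 1) ^ 2 := by
        rw [Finset.mul_sum]
    _ ≤ 4 * D * ∑' k, a k / ((k : ℝ) + 1) ^ 2 := by
        refine mul_le_mul_of_nonneg_left ?_ (by positivity)
        exact hs.sum_le_tsum _ fun k _ => div_nonneg (ha k) (by positivity)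

/-- This is a left Riemann sum of the increasing function exp(-γ(S_n - u)) on [0, S_n], hence at
most its integral. In the induction a new gap y turns the sum s into exp(-γy)(s + y), and 1 + γy ≤
exp(γy). -/
theorem sum_mul_exp_neg_le {γ : ℝ} (hγ : 0 < γ) (y : ℕ → ℝ≥0) (n : ℕ) :
    ∑ j ∈ Finset.range n, (y j : ℝ) * Real.exp (-γ * (((∑ i ∈ Finset.range n, y i : ℝ≥0) : ℝ)
      - (∑ i ∈ Finset.range j, y i : ℝ≥0))) ≤ 1 / γ := by
  induction n with
  | zero => simpa using hγ.le
  | succ n ih =>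
    set S : ℕ → ℝ≥0 := fun n => ∑ i ∈ Finset.range n, y i with hS
    have hSs : S (n + 1) = S n + y n := Finset.sum_range_succ _ _
    change ∑ j ∈ Finset.range (n + 1), (y j : ℝ) * Real.exp (-γ * ((S (n + 1) : ℝ) - S j)) ≤ _
    change ∑ j ∈ Finset.range n, (y j : ℝ) * Real.exp (-γ * ((S n : ℝ) - S j)) ≤ _ at ih
    have e : ∀ j, (y j : ℝ) * Real.exp (-γ * ((S (n + 1) : ℝ) - S j))
        = Real.exp (-γ * y n) * ((y j : ℝ) * Real.exp (-γ * ((S n : ℝ) - S j))) := by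
      intro j
      rw [hSs, mul_left_comm, ← Real.exp_add]
      congr 2
      push_cast
      ring
    rw [Finset.sum_congr rfl fun j _ => e j, ← Finset.mul_sum, Finset.sum_range_succ]
    simp only [sub_self, mul_zero, Real.exp_zero, mul_one]
    have h1 : γ * y n + 1 ≤ Real.exp (γ * y n) := Real.add_one_le_exp _
    calc _ ≤ Real.exp (-γ * y n) * (1 / γ + y n) := by gcongr
      _ = Real.exp (-γ * y n) * (γ * y n + 1) / γ := by field_simp; ring
      _ ≤ Real.exp (-γ * y n) * Real.exp (γ * y n) / γ := by gcongr
      _ = 1 / γ := by rw [← Real.exp_add]; simp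

variable {Ω : Type*} [MeasurableSpace Ω] {P : Measure Ω} [IsProbabilityMeasure P]

/-- Adding index n to the sum adds a diagonal term and twice the cross terms with the past; the
latter are weighted exponential decays, controlled by `sum_mul_exp_neg_le` uniformly in the spacing.
-/
theorem integral_sq_weighted_sum_le {γ K : ℝ} (hγ : 0 < γ) (hK : 0 ≤ K) (y : ℕ → ℝ≥0)
    {G : ℕ → Ω → ℝ} (hG : ∀ k, Measurable (G k)) (hG1 : ∀ k ω, |G k ω| ≤ 1)
    (hcov : ∀ j k, j ≤ k → ∫ ω, G j ω * G k ω ∂P ≤ K * Real.exp (-γ *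
      (((∑ i ∈ Finset.range k, y i : ℝ≥0) : ℝ) - (∑ i ∈ Finset.range j, y i : ℝ≥0)))) (n : ℕ) :
    ∫ ω, (∑ k ∈ Finset.range n, (y k : ℝ) * G k ω) ^ 2 ∂P
      ≤ ∑ k ∈ Finset.range n, K * ((y k : ℝ) ^ 2 + 2 * y k / γ) := by
  have hGG : ∀ j k, Integrable (fun ω => G j ω * G k ω) P := fun j k =>
    Integrable.of_bound ((hG j).mul (hG k)).aestronglyMeasurable 1 (.of_forall fun ω => by
      rw [norm_mul]; exact mul_le_one₀ (hG1 j ω) (norm_nonneg _) (hG1 k ω))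
  have hX : ∀ n, Measurable fun ω => ∑ k ∈ Finset.range n, (y k : ℝ) * G k ω := fun n =>
    Finset.measurable_sum _ fun k _ => (hG k).const_mul _
  induction n with
  | zero => simp
  | succ n ih =>
    have hXb : ∀ n ω, |∑ k ∈ Finset.range n, (y k : ℝ) * G k ω| ≤ ∑ k ∈ Finset.range n, (y k : ℝ) :=
      fun n ω => (Finset.abs_sum_le_sum_abs _ _).trans (Finset.sum_le_sum fun k _ => by
        rw [abs_mul, NNReal.abs_eq]; exact mul_le_of_le_one_right (y k).2 (hG1 k ω))
    have hX2 : Integrable (fun ω => (∑ k ∈ Finset.range n, (y k : ℝ) * G k ω) ^ 2) P :=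
      Integrable.of_bound ((hX n).pow_const 2).aestronglyMeasurable
        ((∑ k ∈ Finset.range n, (y k : ℝ)) ^ 2) (.of_forall fun ω => by
          rw [norm_pow]; exact pow_le_pow_left₀ (norm_nonneg _) (hXb n ω) 2)
    have hcross : Integrable (fun ω => ∑ k ∈ Finset.range n, (y k : ℝ) * (G k ω * G n ω)) P :=
      integrable_finsetSum _ fun k _ => (hGG k n).const_mul _
    have e : ∀ ω, (∑ k ∈ Finset.range (n + 1), (y k : ℝ) * G k ω) ^ 2
        = (∑ k ∈ Finset.range n, (y k : ℝ) * G k ω) ^ 2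
          + (2 * y n * (∑ k ∈ Finset.range n, (y k : ℝ) * (G k ω * G n ω))
          + (y n : ℝ) ^ 2 * (G n ω * G n ω)) := by
      intro ω
      have : ∑ k ∈ Finset.range n, (y k : ℝ) * (G k ω * G n ω)
          = (∑ k ∈ Finset.range n, (y k : ℝ) * G k ω) * G n ω := by
        rw [Finset.sum_mul]; exact Finset.sum_congr rfl fun k _ => by ring
      rw [Finset.sum_range_succ, this]
      ring
    simp_rw [e]
    have hcross' := hcross.const_mul (2 * (y n : ℝ))
    have hsq := (hGG n n).const_mul ((y n : ℝ) ^ 2)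
    rw [integral_add hX2 (by exact hcross'.add hsq), integral_add hcross' hsq,
      integral_const_mul, integral_const_mul, integral_finsetSum _ fun k _ => (hGG k n).const_mul _,
      Finset.sum_range_succ _ n]
    refine add_le_add ih ?_
    have h1 : ∑ k ∈ Finset.range n, ∫ ω, (y k : ℝ) * (G k ω * G n ω) ∂P ≤ K * (1 / γ) := by
      refine le_trans ?_ (mul_le_mul_of_nonneg_left (sum_mul_exp_neg_le hγ y n) hK)
      rw [Finset.mul_sum]
      refine Finset.sum_le_sum fun k hk => ?_
      rw [integral_const_mul, mul_left_comm]
      exact mul_le_mul_of_nonneg_left (hcov k n (Finset.mem_range.1 hk).le) (y k).2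
    have h2 : ∫ ω, G n ω * G n ω ∂P ≤ K := by simpa using hcov n n le_rfl
    calc _ ≤ 2 * (y n : ℝ) * (K * (1 / γ)) + (y n : ℝ) ^ 2 * K := by gcongr
      _ = _ := by ring

theorem ae_tendsto_weighted_average {γ K : ℝ} (hγ : 0 < γ) (hK : 0 ≤ K) (y : ℕ → ℝ≥0)
    (hy : Summable fun k => (y k : ℝ) ^ 2 / ((k : ℝ) + 1) ^ 2)
    {G : ℕ → Ω → ℝ} (hG : ∀ k, Measurable (G k)) (hG1 : ∀ k ω, |G k ω| ≤ 1)
    (hcov : ∀ j k, j ≤ k → ∫ ω, G j ω * G k ω ∂P ≤ K * Real.exp (-γ *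
      (((∑ i ∈ Finset.range k, y i : ℝ≥0) : ℝ) - (∑ i ∈ Finset.range j, y i : ℝ≥0))))
    {c : ℝ} (hc : 1 < c) :
    ∀ᵐ ω ∂P, Tendsto (fun m : ℕ => (∑ k ∈ Finset.range ⌊c ^ m⌋₊, (y k : ℝ) * G k ω) /
      (⌊c ^ m⌋₊ : ℝ)) atTop (𝓝 0) := by
  have hX : ∀ n, Measurable fun ω => ∑ k ∈ Finset.range n, (y k : ℝ) * G k ω := fun n =>
    Finset.measurable_sum _ fun k _ => (hG k).const_mul _
  have hXb : ∀ n ω, |∑ k ∈ Finset.range n, (y k : ℝ) * G k ω| ≤ ∑ k ∈ Finset.range n, (y k : ℝ) :=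
    fun n ω => (Finset.abs_sum_le_sum_abs _ _).trans (Finset.sum_le_sum fun k _ => by
      rw [abs_mul, NNReal.abs_eq]; exact mul_le_of_le_one_right (y k).2 (hG1 k ω))
  have hX2 : ∀ n, Integrable (fun ω => (∑ k ∈ Finset.range n, (y k : ℝ) * G k ω) ^ 2) P :=
    fun n => Integrable.of_bound ((hX n).pow_const 2).aestronglyMeasurable
      ((∑ k ∈ Finset.range n, (y k : ℝ)) ^ 2) (.of_forall fun ω => by
        rw [norm_pow]; exact pow_le_pow_left₀ (norm_nonneg _) (hXb n ω) 2)
  have hone : Summable fun k : ℕ => 1 / ((k : ℝ) + 1) ^ 2 := by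
    have := (summable_nat_add_iff 1).2 (Real.summable_one_div_nat_pow.2 (one_lt_two))
    simpa using this
  have hsum : Summable fun m : ℕ => (∑ k ∈ Finset.range ⌊c ^ m⌋₊,
      K * ((y k : ℝ) ^ 2 + 2 * y k / γ)) / (⌊c ^ m⌋₊ : ℝ) ^ 2 := by
    refine summable_sum_div_floor_pow_sq (fun k => by positivity) ?_ hc
    refine Summable.of_nonneg_of_le (fun k => by positivity) (fun k => ?_)
      ((hy.mul_left (K * (1 + 1 / γ))).add (hone.mul_left (K * (1 / γ))))
    rw [mul_div_assoc', mul_div_assoc', ← add_div]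
    refine div_le_div_of_nonneg_right ?_ (by positivity)
    -- The cross terms are linear in the gap; this lets the hypothesis on squares dominate them.
    have h1 : 2 * (y k : ℝ) ≤ (y k : ℝ) ^ 2 + 1 := by nlinarith [sq_nonneg ((y k : ℝ) - 1)]
    calc _ ≤ K * ((y k : ℝ) ^ 2 + ((y k : ℝ) ^ 2 + 1) / γ) := by gcongr
      _ = _ := by ring
  have h := ae_summable_of_summable_integral (P := P)
    (V := fun m ω => ((∑ k ∈ Finset.range ⌊c ^ m⌋₊, (y k : ℝ) * G k ω) / (⌊c ^ m⌋₊ : ℝ)) ^ 2)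
    (fun m ω => sq_nonneg _) (fun m => by
      simp_rw [div_pow]; exact (hX2 _).div_const _)
    (Summable.of_nonneg_of_le (fun m => integral_nonneg fun ω => sq_nonneg _) (fun m => by
      simp_rw [div_pow]
      rw [integral_div]
      exact div_le_div_of_nonneg_right
        (integral_sq_weighted_sum_le hγ hK y hG hG1 hcov _) (by positivity)) hsum)
  filter_upwards [h] with ω hω
  have h1 := hω.tendsto_atTop_zero
  have h2 := (Real.continuous_sqrt.tendsto 0).comp h1
  rw [Real.sqrt_zero] at h2
  rw [tendsto_zero_iff_abs_tendsto_zero]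
  refine h2.congr fun m => ?_
  simp [Real.sqrt_sq_eq_abs]

theorem tendsto_floor_pow {a : ℝ} (ha : 1 < a) :
    Tendsto (fun m : ℕ => ⌊a ^ m⌋₊) atTop atTop :=
  tendsto_nat_floor_atTop.comp (tendsto_pow_atTop_atTop_of_one_lt ha)

/-- For a fixed sequence of update gaps, the time-weighted average of the idle indicators
observed by the updates. -/
theorem IsErlangLossSystem.ae_tendsto_weighted_average {C : ℕ} {lam μ : ℝ}
    {c : ℝ≥0 → Ω → Fin (C + 1)} (hc : IsErlangLossSystem C lam μ c P)
    (hlam : 0 < lam) (hμ : 0 < μ) (y : ℕ → ℝ≥0)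
    (hy : Summable fun k => (y k : ℝ) ^ 2 / ((k : ℝ) + 1) ^ 2) {l : ℝ}
    (hl : Tendsto (fun n : ℕ => (∑ k ∈ Finset.range n, (y k : ℝ)) / n) atTop (𝓝 l)) :
    ∀ᵐ ω ∂P, Tendsto (fun n : ℕ => (∑ k ∈ Finset.range n, (y k : ℝ) *
      idleIndicator (Function.leftLim (fun u => c u ω) (∑ i ∈ Finset.range k, y i))) / n) atTop
      (𝓝 (l * pIdle lam μ C)) := by
  obtain ⟨γ, K, hγ, hK, hcov⟩ := hc.leftLim_covariance_bound hlam hμ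
  have h1 : ∀ j : ℕ, ∀ᵐ ω ∂P, Tendsto (fun m : ℕ =>
      (∑ k ∈ Finset.range ⌊(1 + 1 / ((j : ℝ) + 1)) ^ m⌋₊, (y k : ℝ) *
        (idleIndicator (Function.leftLim (fun u => c u ω) (∑ i ∈ Finset.range k, y i))
          - pIdle lam μ C)) / (⌊(1 + 1 / ((j : ℝ) + 1)) ^ m⌋₊ : ℝ)) atTop (𝓝 0) := fun j =>
    _root_.ae_tendsto_weighted_average hγ hK y hy
      (fun k => (measurable_idleIndicator.comp (hc.measurable_leftLim_idle _)).sub_const _)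
      (fun k ω => abs_idleIndicator_sub_le hlam hμ _)
      (fun j k hjk => hcov _ _ (Finset.sum_le_sum_of_subset (Finset.range_mono hjk)))
      (by have : (0 : ℝ) < 1 / ((j : ℝ) + 1) := by positivity
          linarith)
  filter_upwards [ae_all_iff.2 h1] with ω hω
  -- The uncentred sums have nonnegative terms, so convergence along ⌊a^m⌋ for ratios a decreasing
  -- to 1 extends to all n.
  refine tendsto_div_of_monotone_of_tendsto_div_floor_pow _ _ ?_
    (fun j : ℕ => 1 + 1 / ((j : ℝ) + 1)) (fun j => ?_) ?_ fun j => ?_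
  · refine monotone_nat_of_le_succ fun n => ?_
    rw [Finset.sum_range_succ]
    exact le_add_of_nonneg_right (mul_nonneg (y n).2 (idleIndicator_nonneg _))
  · have : (0 : ℝ) < 1 / ((j : ℝ) + 1) := by positivity
    linarith
  · simpa using (tendsto_const_nhds (x := (1 : ℝ))).add
      (tendsto_one_div_add_atTop_nhds_zero_nat (𝕜 := ℝ))
  · have hj : (1 : ℝ) < 1 + 1 / ((j : ℝ) + 1) := by
      have : (0 : ℝ) < 1 / ((j : ℝ) + 1) := by positivity
      linarith
    have h2 := (hω j).add ((hl.comp (tendsto_floor_pow hj)).mul_const (pIdle lam μ C))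
    rw [zero_add] at h2
    refine h2.congr fun m => ?_
    simp only [Function.comp_apply, mul_sub, Finset.sum_sub_distrib, ← Finset.sum_mul]
    ring

end WeightedSums

/-! ### Almost sure behaviour of the update gaps -/

section Gaps

variable {Ω : Type*} [MeasurableSpace Ω] {P : Measure Ω} [IsProbabilityMeasure P]
  {Y : ℕ → Ω → ℝ≥0} {r : ℝ}

theorem IsUpdateGaps.ae_tendsto_average (hY : IsUpdateGaps Y r P) :
    ∀ᵐ ω ∂P, Tendsto (fun n : ℕ => (∑ k ∈ Finset.range n, (Y k ω : ℝ)) / n) atTop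
      (𝓝 (1 / r)) := by
  have h := strong_law_ae_real (μ := P) (fun k ω => (Y k ω : ℝ)) hY.integrable
    (fun i j hij => (hY.indep.indepFun hij).comp measurable_coe_nnreal_real measurable_coe_nnreal_real)
    (fun i => (hY.identDistrib i).comp measurable_coe_nnreal_real)
  rwa [hY.mean] at h

/-- No second moment is assumed. As in Etemadi's strong law, the gaps are truncated at level k: the
truncated squares have summable weighted expectations, and Y_k > k occurs only finitely often. -/
theorem IsUpdateGaps.ae_summable_sq (hY : IsUpdateGaps Y r P) :
    ∀ᵐ ω ∂P, Summable fun k : ℕ => (Y k ω : ℝ) ^ 2 / ((k : ℝ) + 1) ^ 2 := by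
  let _ : MeasureSpace Ω := ⟨P⟩
  have hP : IsProbabilityMeasure (volume : Measure Ω) := ‹IsProbabilityMeasure P›
  have hident : ∀ k, IdentDistrib (fun ω => (Y k ω : ℝ)) (fun ω => (Y 0 ω : ℝ)) P P :=
    fun k => (hY.identDistrib k).comp measurable_coe_nnreal_real
  have hnn : 0 ≤ fun ω => (Y 0 ω : ℝ) := fun ω => (Y 0 ω).coe_nonneg
  have hmeas : ∀ k, Measurable fun ω => (Y k ω : ℝ) := fun k =>
    measurable_coe_nnreal_real.comp (hY.measurable k)
  have h1 : ∀ᵐ ω ∂P, ∀ᶠ k : ℕ in atTop, ω ∉ {ω | (Y k ω : ℝ) ∈ Set.Ioi (k : ℝ)} := by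
    refine ae_eventually_notMem ?_
    have := (tsum_prob_mem_Ioi_lt_top (Ω := Ω) hY.integrable hnn).ne
    convert! this using 3 with k
    exact (hident k).measure_mem_eq measurableSet_Ioi
  have h2 : ∀ᵐ ω ∂P, Summable fun k : ℕ =>
      ((k : ℝ) ^ 2)⁻¹ * (truncation (fun ω => (Y k ω : ℝ)) k ω) ^ 2 := by
    refine ae_summable_of_summable_integral (fun k ω => by positivity) (fun k => ?_) ?_
    · refine Integrable.const_mul ?_ _
      exact ((hmeas k).aestronglyMeasurable.memLp_truncation).integrable_sq
    · refine summable_of_sum_range_le (c := 2 * ∫ ω, (Y 0 ω : ℝ) ∂P)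
        (fun k => integral_nonneg fun ω => by positivity) fun K => ?_
      refine le_trans (Finset.sum_le_sum fun k _ => le_of_eq ?_)
        (sum_variance_truncation_le (Ω := Ω) hY.integrable hnn K)
      rw [integral_const_mul]
      congr 1
      have := ((hident k).truncation (A := k)).comp (measurable_id.pow_const 2)
      exact this.integral_eq
  filter_upwards [h1, h2] with ω hω1 hω2
  obtain ⟨k0, hk0⟩ := eventually_atTop.1 hω1
  -- The extra 1 makes the truncation level A positive, so that a zero gap lies in the half-open
  -- interval (-A, A].
  rw [← summable_nat_add_iff (k0 + 1)]
  refine Summable.of_nonneg_of_le (fun k => by positivity) (fun k => ?_)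
    ((summable_nat_add_iff (k0 + 1)).2 hω2)
  have hk := hk0 (k + (k0 + 1)) (by omega)
  have hle : (Y (k + (k0 + 1)) ω : ℝ) ≤ ((k + (k0 + 1) : ℕ) : ℝ) := not_lt.1 hk
  have ht : truncation (fun ω => (Y (k + (k0 + 1)) ω : ℝ)) ((k + (k0 + 1) : ℕ) : ℝ) ω
      = Y (k + (k0 + 1)) ω := by
    simp only [truncation, Function.comp_apply, Set.indicator_apply, Set.mem_Ioc, id]
    rw [if_pos]
    refine ⟨lt_of_lt_of_le ?_ (NNReal.coe_nonneg _), hle⟩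
    simp only [Left.neg_neg_iff, Nat.cast_pos]
    omega
  rw [ht, div_eq_inv_mul]
  gcongr
  · exact le_add_of_nonneg_right zero_le_one

end Gaps

/-! ### The most recent update and the cache along a path -/

section LastUpdate

variable {Ω : Type*} {Y : ℕ → Ω → ℝ≥0} {ω : Ω}

theorem updateTime_mono (ω : Ω) : Monotone fun n => updateTime Y n ω :=
  fun _ _ h => Finset.sum_le_sum_of_subset (Finset.range_mono h)

/-- Individual gaps may vanish; divergence comes from the positive limit of S_n / n. -/
theorem tendsto_updateTime {r : ℝ} (hr : 0 < r)
    (h : Tendsto (fun n : ℕ => (∑ k ∈ Finset.range n, (Y k ω : ℝ)) / n) atTop (𝓝 (1 / r))) :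
    Tendsto (fun n => updateTime Y n ω) atTop atTop := by
  rw [← NNReal.tendsto_coe_atTop]
  have h1 := h.pos_mul_atTop (by positivity) (tendsto_natCast_atTop_atTop (R := ℝ))
  refine h1.congr' ?_
  filter_upwards [eventually_gt_atTop 0] with n hn
  rw [div_mul_cancel₀ _ (by positivity)]
  simp [updateTime]

theorem lastUpdate_spec_of_exists {t : ℝ≥0} (h : ∃ n, t < updateTime Y n ω) :
    updateTime Y (lastUpdate Y t ω) ω ≤ t ∧ t < updateTime Y (lastUpdate Y t ω + 1) ω := by
  obtain ⟨n, hn⟩ := h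
  have hb : BddAbove {k | updateTime Y k ω ≤ t} := ⟨n, fun k hk => by
    by_contra hlt
    exact (hn.trans_le (updateTime_mono ω (not_le.1 hlt).le)).not_ge hk⟩
  refine ⟨Nat.sSup_mem (s := {k | updateTime Y k ω ≤ t}) ⟨0, by simp [updateTime]⟩ hb, ?_⟩
  by_contra hlt
  have := le_csSup hb (show lastUpdate Y t ω + 1 ∈ {k | updateTime Y k ω ≤ t} from not_lt.1 hlt)
  exact absurd this (by unfold lastUpdate; omega)

theorem lastUpdate_eq_iff_of_exists {t : ℝ≥0} (h : ∃ n, t < updateTime Y n ω) (n : ℕ) :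
    lastUpdate Y t ω = n ↔ updateTime Y n ω ≤ t ∧ t < updateTime Y (n + 1) ω := by
  constructor
  · rintro rfl
    exact lastUpdate_spec_of_exists h
  · rintro ⟨h1, h2⟩
    obtain ⟨h3, h4⟩ := lastUpdate_spec_of_exists h
    have h5 := (updateTime_mono (Y := Y) ω).reflect_lt (h1.trans_lt h4)
    have h6 := (updateTime_mono (Y := Y) ω).reflect_lt (h3.trans_lt h2)
    omega

theorem lastUpdate_spec (h : Tendsto (fun n => updateTime Y n ω) atTop atTop) (t : ℝ≥0) :
    updateTime Y (lastUpdate Y t ω) ω ≤ t ∧ t < updateTime Y (lastUpdate Y t ω + 1) ω :=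
  lastUpdate_spec_of_exists (h.eventually_gt_atTop t).exists

theorem lastUpdate_eq_iff (h : Tendsto (fun n => updateTime Y n ω) atTop atTop) (t : ℝ≥0)
    (n : ℕ) : lastUpdate Y t ω = n ↔ updateTime Y n ω ≤ t ∧ t < updateTime Y (n + 1) ω :=
  lastUpdate_eq_iff_of_exists (h.eventually_gt_atTop t).exists n

theorem lastUpdate_mono (h : Tendsto (fun n => updateTime Y n ω) atTop atTop) :
    Monotone fun t => lastUpdate Y t ω := by
  intro s t hst
  have h1 := (lastUpdate_spec h s).1
  have h2 := (lastUpdate_spec h t).2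
  have h3 := (updateTime_mono (Y := Y) ω).reflect_lt ((h1.trans hst).trans_lt h2)
  exact Nat.lt_succ_iff.1 h3

theorem tendsto_lastUpdate (h : Tendsto (fun n => updateTime Y n ω) atTop atTop) :
    Tendsto (fun t => lastUpdate Y t ω) atTop atTop := by
  refine tendsto_atTop.2 fun n => ?_
  filter_upwards [eventually_ge_atTop (updateTime Y n ω)] with t ht
  have h2 := (lastUpdate_spec h t).2
  exact Nat.lt_succ_iff.1 ((updateTime_mono (Y := Y) ω).reflect_lt (ht.trans_lt h2))

theorem cachedState_eq_of_mem {C : ℕ} (c : ℝ≥0 → Ω → Fin (C + 1))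
    (h : Tendsto (fun n => updateTime Y n ω) atTop atTop) {t : ℝ≥0} {n : ℕ}
    (h1 : updateTime Y n ω ≤ t) (h2 : t < updateTime Y (n + 1) ω) :
    cachedState c Y t ω = Function.leftLim (fun s => c s ω) (updateTime Y n ω) := by
  rw [cachedState, (lastUpdate_eq_iff h t n).2 ⟨h1, h2⟩]

/-- The interval on which an update is the latest is closed on the left and open on the right, so
the cache is right-continuous although it stores left limits. -/
theorem cachedState_eventually_eq {C : ℕ} (c : ℝ≥0 → Ω → Fin (C + 1))
    (h : Tendsto (fun n => updateTime Y n ω) atTop atTop) (t : ℝ≥0) :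
    ∀ᶠ u in 𝓝[≥] t, cachedState c Y u ω = cachedState c Y t ω := by
  obtain ⟨h1, h2⟩ := lastUpdate_spec h t
  filter_upwards [self_mem_nhdsWithin, nhdsWithin_le_nhds (Iio_mem_nhds h2)] with u hu1 hu2
  exact cachedState_eq_of_mem c h (h1.trans hu1) hu2

theorem measurable_cachedState_path {C : ℕ} (c : ℝ≥0 → Ω → Fin (C + 1))
    (h : Tendsto (fun n => updateTime Y n ω) atTop atTop) :
    Measurable fun t => cachedState c Y t ω := by
  have h1 : Measurable fun t => lastUpdate Y t ω := (lastUpdate_mono h).measurable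
  exact (Measurable.of_discrete
    (f := fun n => Function.leftLim (fun s => c s ω) (updateTime Y n ω))).comp h1

end LastUpdate

/-! ### Measurability, and averages seen by the updates -/

section Measurability

variable {Ω : Type*} [MeasurableSpace Ω] {P : Measure Ω}
  {C : ℕ} {lam μ : ℝ} {c : ℝ≥0 → Ω → Fin (C + 1)} {Y : ℕ → Ω → ℝ≥0}

theorem measurable_updateTime (hY : ∀ k, Measurable (Y k)) (n : ℕ) :
    Measurable (updateTime Y n) :=
  Finset.measurable_sum _ fun k _ => hY k

theorem measurable_lastUpdate (hY : ∀ k, Measurable (Y k)) (t : ℝ≥0) :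
    Measurable (lastUpdate Y t) := by
  have hm := measurable_updateTime hY
  have hE : MeasurableSet {ω | ∃ n, t < updateTime Y n ω} := by
    have : {ω | ∃ n, t < updateTime Y n ω} = ⋃ n, {ω | t < updateTime Y n ω} := by ext; simp
    rw [this]
    exact MeasurableSet.iUnion fun n => measurableSet_lt measurable_const (hm n)
  refine measurable_to_countable' fun n => ?_
  have hset : lastUpdate Y t ⁻¹' {n} =
      ({ω | ∃ n, t < updateTime Y n ω} ∩
        {ω | updateTime Y n ω ≤ t ∧ t < updateTime Y (n + 1) ω})
      ∪ ({ω | ∃ n, t < updateTime Y n ω}ᶜ ∩ {_ω | n = 0}) := by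
    ext ω
    by_cases hω : ∃ n, t < updateTime Y n ω
    · simp only [Set.mem_preimage, Set.mem_singleton_iff, lastUpdate_eq_iff_of_exists hω, Set.mem_union, Set.mem_inter_iff,
        Set.mem_ofPred_eq, hω, true_and, Set.mem_compl_iff, not_true, false_and, or_false]
    -- If no update time exceeds t, the defining set is all of ℕ and its supremum takes the default
    -- value 0.
    · have h0 : lastUpdate Y t ω = 0 := by
        have : {k | updateTime Y k ω ≤ t} = Set.univ := by
          ext k
          simp [not_lt.1 fun h => hω ⟨k, h⟩]
        rw [lastUpdate, this]
        exact Nat.sSup_of_not_bddAbove (by simp)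
      simp only [Set.mem_preimage, Set.mem_singleton_iff, h0, Set.mem_union, Set.mem_inter_iff,
        Set.mem_ofPred_eq, hω, false_and, Set.mem_compl_iff, not_false_iff, true_and, false_or]
      exact eq_comm
  rw [hset]
  exact (hE.inter ((measurableSet_le (hm n) measurable_const).inter
    (measurableSet_lt measurable_const (hm (n + 1))))).union
    (hE.compl.inter (MeasurableSet.const _))

theorem measurable_updateTime_lastUpdate (hY : ∀ k, Measurable (Y k)) (t : ℝ≥0) :
    Measurable fun ω => updateTime Y (lastUpdate Y t ω) ω := by
  have h : Measurable fun p : ℕ × Ω => updateTime Y p.1 p.2 :=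
    measurable_from_prod_countable_right fun n => measurable_updateTime hY n
  exact h.comp ((measurable_lastUpdate hY t).prodMk measurable_id)

theorem measurable_gridBelow_index (m : ℕ) :
    Measurable fun s : ℝ≥0 => ⌈((m : ℝ≥0) + 1) * s⌉₊ - 1 :=
  (Measurable.of_discrete (f := fun n : ℕ => n - 1)).comp
    (Nat.measurable_ceil.comp (measurable_const_mul _))

theorem measurable_path_gridBelow {E : Type*} [MeasurableSpace E] (m : ℕ) :
    Measurable fun p : (ℝ≥0 → E) × ℝ≥0 => p.1 (gridBelow m p.2) := by
  have h := measurable_path_apply_comp_nat (E := E) (fun n => (n : ℝ≥0) / (m + 1))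
    (measurable_gridBelow_index m)
  unfold gridBelow
  exact h

theorem IsErlangLossSystem.measurable_leftLim_comp (hc : IsErlangLossSystem C lam μ c P)
    {T : Ω → ℝ≥0} (hT : Measurable T) :
    Measurable fun ω => Function.leftLim (fun s => c s ω) (T ω) := by
  refine measurable_of_tendsto_metrizable (f := fun m ω => c (gridBelow m (T ω)) ω)
    (fun m => ?_) ?_
  · exact (measurable_path_gridBelow m).comp ((measurable_pi_lambda _ hc.measurable).prodMk hT)
  · rw [tendsto_pi_nhds]
    intro ω
    refine tendsto_const_nhds.congr' ?_
    filter_upwards [eventually_gridBelow_eq_leftLim (hc.cadlag ω) (T ω)] with m h1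
    rw [← h1]

theorem IsErlangLossSystem.measurable_cachedState (hc : IsErlangLossSystem C lam μ c P)
    (hY : ∀ k, Measurable (Y k)) (t : ℝ≥0) : Measurable (cachedState c Y t) :=
  hc.measurable_leftLim_comp (measurable_updateTime_lastUpdate hY t)

variable [IsProbabilityMeasure P]

/-- The time of the latest update is a function of the gaps alone, hence independent of the server,
and the left limit there is attained along a grid. -/
theorem IsErlangLossSystem.measureReal_cached_idle_of_inSteadyState
    (hc : IsErlangLossSystem C lam μ c P) (hlam : 0 < lam) (hμ : 0 < μ)
    (hY : ∀ k, Measurable (Y k)) (hcY : IndepFun (fun ω t => c t ω) (fun ω k => Y k ω) P)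
    (hs : InSteadyState c P) (t : ℝ≥0) :
    P.real {ω | 0 < cachedState c Y t ω} = pIdle lam μ C := by
  have h0 : ∀ s, P {ω | c s ω ∈ {x : Fin (C + 1) | 0 < x}} = P {ω | 0 < c 0 ω} := by
    intro s
    have h1 := hc.measureReal_idle_of_inSteadyState hlam hμ hs s
    rw [← hc.measureReal_idle_of_inSteadyState hlam hμ hs 0] at h1
    exact (measureReal_eq_measureReal_iff).1 h1
  have hT : Measurable fun y : ℕ → ℝ≥0 =>
      updateTime (fun k (y : ℕ → ℝ≥0) => y k) (lastUpdate (fun k (y : ℕ → ℝ≥0) => y k) t y) y :=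
    measurable_updateTime_lastUpdate (fun k => measurable_pi_apply k) t
  have h := measure_independent_sample_of_eventually (P := P) hc.measurable
    (measurable_updateTime_lastUpdate hY t) (hcY.comp measurable_id hT)
    (fun m n => (n : ℝ≥0) / (m + 1)) measurable_gridBelow_index
    (Set.toFinite {x : Fin (C + 1) | 0 < x}).measurableSet h0 (W := cachedState c Y t)
    (.of_forall fun ω => eventually_gridBelow_eq_leftLim (hc.cadlag ω) _)
  rw [← hc.measureReal_idle_of_inSteadyState hlam hμ hs 0]
  exact congrArg ENNReal.toReal h

/-- The fraction of time, weighted by update gaps, that the updates show an idle thread. -/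
theorem IsErlangLossSystem.ae_tendsto_update_average (hc : IsErlangLossSystem C lam μ c P)
    (hlam : 0 < lam) (hμ : 0 < μ) {r : ℝ} (hY : IsUpdateGaps Y r P)
    (hcY : IndepFun (fun ω t => c t ω) (fun ω k => Y k ω) P) :
    ∀ᵐ ω ∂P, Tendsto (fun n : ℕ => (∑ k ∈ Finset.range n, (Y k ω : ℝ) *
      idleIndicator (Function.leftLim (fun u => c u ω) (updateTime Y k ω))) / n) atTop
      (𝓝 (1 / r * pIdle lam μ C)) := by
  -- The limsup over the grid is measurable on all paths, and on càdlàg paths it is the idle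
  -- indicator of the left limit.
  set L : (ℝ≥0 → Fin (C + 1)) × ℝ≥0 → ℝ :=
    fun p => limsup (fun m => idleIndicator (p.1 (gridBelow m p.2))) atTop with hL
  have hLm : Measurable L := by
    have h1 : ∀ m, Measurable fun p : (ℝ≥0 → Fin (C + 1)) × ℝ≥0 =>
        idleIndicator (p.1 (gridBelow m p.2)) := fun m =>
      measurable_idleIndicator.comp (measurable_path_gridBelow m)
    exact Measurable.limsup h1
  have hLc : ∀ ω s, L (fun t => c t ω, s)
      = idleIndicator (Function.leftLim (fun u => c u ω) s) := by
    intro ω s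
    refine Tendsto.limsup_eq (tendsto_const_nhds.congr' ?_)
    filter_upwards [eventually_gridBelow_eq_leftLim (hc.cadlag ω) s] with m h1
    rw [← h1]
  set B : Set ((ℝ≥0 → Fin (C + 1)) × (ℕ → ℝ≥0)) := {p | Tendsto (fun n : ℕ =>
    (∑ k ∈ Finset.range n, (p.2 k : ℝ) * L (p.1, ∑ i ∈ Finset.range k, p.2 i)) / n) atTop
      (𝓝 (1 / r * pIdle lam μ C))} with hB
  have hBm : MeasurableSet B := by
    refine measurableSet_tendsto _ fun n => Measurable.div_const
      (Finset.measurable_sum _ fun k _ => Measurable.mul ?_ (hLm.comp ?_)) _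
    · exact measurable_coe_nnreal_real.comp ((measurable_pi_apply k).comp measurable_snd)
    · exact measurable_fst.prodMk
        (Finset.measurable_sum _ fun i _ => (measurable_pi_apply i).comp measurable_snd)
  have hc' : Measurable fun ω t => c t ω := measurable_pi_lambda _ hc.measurable
  have hY' : Measurable fun ω k => Y k ω := measurable_pi_lambda _ hY.measurable
  have : IsProbabilityMeasure (P.map fun ω t => c t ω) :=
    Measure.isProbabilityMeasure_map hc'.aemeasurable
  have : IsProbabilityMeasure (P.map fun ω k => Y k ω) :=
    Measure.isProbabilityMeasure_map hY'.aemeasurable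
  have hyconv : ∀ᵐ y ∂(P.map fun ω k => Y k ω),
      Tendsto (fun n : ℕ => (∑ k ∈ Finset.range n, (y k : ℝ)) / n) atTop (𝓝 (1 / r)) := by
    rw [ae_map_iff hY'.aemeasurable]
    · exact hY.ae_tendsto_average
    · exact measurableSet_tendsto _ fun n => (Finset.measurable_sum _ fun k _ =>
        measurable_coe_nnreal_real.comp (measurable_pi_apply k)).div_const _
  -- Summability is recast as finiteness of an extended sum, a measurable condition that can be
  -- transported to the law of the gaps.
  have hysum : ∀ᵐ y ∂(P.map fun ω k => Y k ω),
      ∑' k : ℕ, ENNReal.ofReal ((y k : ℝ) ^ 2 / ((k : ℝ) + 1) ^ 2) < ∞ := by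
    rw [ae_map_iff hY'.aemeasurable]
    · filter_upwards [hY.ae_summable_sq] with ω hω using hω.tsum_ofReal_lt_top
    · refine measurableSet_lt (Measurable.tsum fun k => ?_) measurable_const
      exact ((measurable_coe_nnreal_real.comp (measurable_pi_apply k)).pow_const 2
        |>.div_const _).ennreal_ofReal
  -- Fubini: for almost every frozen gap sequence the result for deterministic update times applies.
  have hprod : (P.map fun ω => ((fun t => c t ω), fun k => Y k ω)) Bᶜ = 0 := by
    rw [hcY.map_prod_eq_prod_map_map hc'.aemeasurable hY'.aemeasurable,
      Measure.prod_apply_symm hBm.compl, lintegral_eq_zero_iff (measurable_measure_prodMk_right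
        hBm.compl)]
    filter_upwards [hyconv, hysum] with y hy1 hy2
    have hsum : Summable fun k : ℕ => (y k : ℝ) ^ 2 / ((k : ℝ) + 1) ^ 2 := by
      have := ENNReal.summable_toReal hy2.ne
      refine this.congr fun k => ENNReal.toReal_ofReal (by positivity)
    rw [Measure.map_apply hc' (measurable_prodMk_right hBm.compl)]
    have h := hc.ae_tendsto_weighted_average hlam hμ y hsum hy1
    refine measure_mono_null (fun ω hω => ?_) (ae_iff.1 h)
    intro hconv
    refine hω ?_
    change Tendsto _ _ _
    simpa only [hLc] using hconv
  rw [Measure.map_apply (hc'.prodMk hY') hBm.compl] at hprod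
  rw [ae_iff]
  refine measure_mono_null (fun ω hω => ?_) hprod
  intro hmem
  refine hω ?_
  have h2 : Tendsto (fun n : ℕ => (∑ k ∈ Finset.range n, (Y k ω : ℝ) *
    L (fun t => c t ω, ∑ i ∈ Finset.range k, Y i ω)) / n) atTop (𝓝 (1 / r * pIdle lam μ C)) := hmem
  simp only [hLc] at h2
  exact h2

end Measurability

/-! ### Interpolation between the points of a sequence -/

section Interpolation

/-- The ratio is squeezed between u(N)/s(N+1) and u(N+1)/s(N), which share the limit p. It is used
between update times and between integers. -/
theorem tendsto_div_of_interpolation {α : Type*} {l : Filter α} {V t : α → ℝ} {N : α → ℕ}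
    (hN : Tendsto N l atTop) {u s : ℕ → ℝ} {p : ℝ} (hs : Tendsto s atTop atTop)
    (hus : Tendsto (fun n => u n / s n) atTop (𝓝 p))
    (hss : Tendsto (fun n => s (n + 1) / s n) atTop (𝓝 1)) (hu : ∀ n, 0 ≤ u n)
    (h : ∀ᶠ x in l, s (N x) ≤ t x ∧ t x ≤ s (N x + 1) ∧ u (N x) ≤ V x ∧ V x ≤ u (N x + 1)) :
    Tendsto (fun x => V x / t x) l (𝓝 p) := by
  have hpos := hs.eventually_gt_atTop 0
  have hlow : Tendsto (fun n => u n / s (n + 1)) atTop (𝓝 p) := by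
    have := hus.div hss one_ne_zero
    rw [div_one] at this
    refine this.congr' ?_
    filter_upwards [hpos] with n hn
    simp only [Pi.div_apply]
    rw [div_div_div_cancel_right₀ hn.ne']
  have hupp : Tendsto (fun n => u (n + 1) / s n) atTop (𝓝 p) := by
    have := ((tendsto_add_atTop_iff_nat 1).2 hus).mul hss
    rw [mul_one] at this
    refine this.congr' ?_
    filter_upwards [(tendsto_add_atTop_iff_nat 1).2 hs |>.eventually_gt_atTop 0] with n hn
    rw [div_mul_div_cancel₀ hn.ne']
  refine tendsto_of_tendsto_of_tendsto_of_le_of_le' (hlow.comp hN) (hupp.comp hN) ?_ ?_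
  · filter_upwards [h, hN.eventually hpos] with x ⟨h1, h2, h3, h4⟩ h5
    exact div_le_div₀ ((hu _).trans h3) h3 (h5.trans_le h1) h2
  · filter_upwards [h, hN.eventually hpos] with x ⟨h1, h2, h3, h4⟩ h5
    exact div_le_div₀ (hu _) h4 h5 h1

theorem tendsto_succ_div_of_tendsto_div {s : ℕ → ℝ} {a : ℝ} (ha : a ≠ 0)
    (h : Tendsto (fun n : ℕ => s n / n) atTop (𝓝 a)) :
    Tendsto (fun n => s (n + 1) / s n) atTop (𝓝 1) := by
  have h1 : Tendsto (fun n : ℕ => ((n + 1 : ℕ) : ℝ) / n) atTop (𝓝 1) := by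
    have := (tendsto_const_nhds (x := (1 : ℝ))).add (tendsto_one_div_atTop_nhds_zero_nat (𝕜 := ℝ))
    rw [add_zero] at this
    refine this.congr' ?_
    filter_upwards [eventually_gt_atTop 0] with n hn
    push_cast
    field_simp
  have h2 := (((tendsto_add_atTop_iff_nat 1).2 h).mul h1).div h ha
  rw [mul_one, div_self ha] at h2
  refine h2.congr' ?_
  filter_upwards [eventually_gt_atTop 0] with n hn
  have hn' : (n : ℝ) ≠ 0 := by positivity
  simp only [Pi.div_apply]
  rw [div_mul_div_cancel₀ (by positivity), div_div_div_cancel_right₀ hn']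

end Interpolation

/-! ### Long-run idle fraction of the cache -/

section CachedFraction

variable {Ω : Type*} {C : ℕ} {Y : ℕ → Ω → ℝ≥0} {ω : Ω}

theorem intervalIntegrable_cached_idle (c : ℝ≥0 → Ω → Fin (C + 1))
    (h : Tendsto (fun n => updateTime Y n ω) atTop atTop) (a b : ℝ) :
    IntervalIntegrable (fun t : ℝ => idleIndicator (cachedState c Y t.toNNReal ω)) volume a b := by
  rw [intervalIntegrable_iff]
  refine Measure.integrableOn_of_bounded (M := 1) measure_Ioc_lt_top.ne ?_ (.of_forall fun t => ?_)
  · exact (measurable_idleIndicator.comp ((measurable_cachedState_path c h).comp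
      measurable_real_toNNReal)).aestronglyMeasurable
  · rw [Real.norm_eq_abs, abs_of_nonneg (idleIndicator_nonneg _)]
    exact idleIndicator_le_one _

theorem integral_cached_idle_updateTime (c : ℝ≥0 → Ω → Fin (C + 1))
    (h : Tendsto (fun n => updateTime Y n ω) atTop atTop) (n : ℕ) :
    ∫ t in (0 : ℝ)..updateTime Y n ω, idleIndicator (cachedState c Y t.toNNReal ω)
      = ∑ k ∈ Finset.range n, (Y k ω : ℝ) *
        idleIndicator (Function.leftLim (fun s => c s ω) (updateTime Y k ω)) := by
  have h0 : ((updateTime Y 0 ω : ℝ≥0) : ℝ) = 0 := by simp [updateTime]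
  rw [← h0, ← intervalIntegral.sum_integral_adjacent_intervals
    (a := fun n => ((updateTime Y n ω : ℝ≥0) : ℝ))
    fun k _ => intervalIntegrable_cached_idle c h _ _]
  refine Finset.sum_congr rfl fun k _ => ?_
  have hle : ((updateTime Y k ω : ℝ≥0) : ℝ) ≤ updateTime Y (k + 1) ω :=
    updateTime_mono ω k.le_succ
  rw [intervalIntegral.integral_congr_Ioo_of_le (g := fun _ =>
    idleIndicator (Function.leftLim (fun s => c s ω) (updateTime Y k ω))) hle]
  · rw [intervalIntegral.integral_const, smul_eq_mul]
    congr 1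
    simp [updateTime, Finset.sum_range_succ]
  · intro t ht
    dsimp only
    rw [cachedState_eq_of_mem c h (n := k)]
    · exact NNReal.le_toNNReal_of_coe_le ht.1.le
    · rw [Real.toNNReal_lt_iff_lt_coe ((NNReal.coe_nonneg _).trans ht.1.le)]
      exact ht.2

theorem integral_cached_idle_mono (c : ℝ≥0 → Ω → Fin (C + 1))
    (h : Tendsto (fun n => updateTime Y n ω) atTop atTop) {a b : ℝ} (hab : a ≤ b) :
    ∫ t in (0 : ℝ)..a, idleIndicator (cachedState c Y t.toNNReal ω)
      ≤ ∫ t in (0 : ℝ)..b, idleIndicator (cachedState c Y t.toNNReal ω) := by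
  rw [← sub_nonneg, intervalIntegral.integral_interval_sub_left
    (intervalIntegrable_cached_idle c h _ _) (intervalIntegrable_cached_idle c h _ _)]
  exact intervalIntegral.integral_nonneg hab fun t _ => idleIndicator_nonneg _

theorem cachedIdleFraction_eq (c : ℝ≥0 → Ω → Fin (C + 1)) (T : ℝ) :
    cachedIdleFraction c Y T ω
      = (∫ t in (0 : ℝ)..T, idleIndicator (cachedState c Y t.toNNReal ω)) / T := rfl

/-- A renewal-reward argument: dividing the averages of reward and gap gives the fraction at update
times, and the integral is monotone in between. -/
theorem tendsto_cachedIdleFraction {r p : ℝ} (hr : 0 < r) (c : ℝ≥0 → Ω → Fin (C + 1))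
    (hY : Tendsto (fun n : ℕ => (∑ k ∈ Finset.range n, (Y k ω : ℝ)) / n) atTop (𝓝 (1 / r)))
    (hX : Tendsto (fun n : ℕ => (∑ k ∈ Finset.range n, (Y k ω : ℝ) *
      idleIndicator (Function.leftLim (fun u => c u ω) (updateTime Y k ω))) / n) atTop
      (𝓝 (1 / r * p))) :
    Tendsto (fun T : ℝ => cachedIdleFraction c Y T ω) atTop (𝓝 p) := by
  have hS := tendsto_updateTime hr hY
  have hS' : Tendsto (fun n => ((updateTime Y n ω : ℝ≥0) : ℝ)) atTop atTop :=
    NNReal.tendsto_coe_atTop.2 hS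
  have hsn : Tendsto (fun n : ℕ => ((updateTime Y n ω : ℝ≥0) : ℝ) / n) atTop (𝓝 (1 / r)) := by
    simpa [updateTime] using hY
  have hr' : 1 / r ≠ 0 := by positivity
  simp only [cachedIdleFraction_eq]
  refine tendsto_div_of_interpolation (N := fun T : ℝ => lastUpdate Y T.toNNReal ω)
    ((tendsto_lastUpdate hS).comp tendsto_real_toNNReal_atTop) hS'
    (u := fun n => ∑ k ∈ Finset.range n, (Y k ω : ℝ) *
        idleIndicator (Function.leftLim (fun s => c s ω) (updateTime Y k ω))) ?_
    (tendsto_succ_div_of_tendsto_div hr' hsn)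
    (fun n => Finset.sum_nonneg fun k _ => mul_nonneg (NNReal.coe_nonneg _)
      (idleIndicator_nonneg _)) ?_
  · have := hX.div hsn hr'
    rw [mul_div_cancel_left₀ _ hr'] at this
    refine this.congr' ?_
    filter_upwards [eventually_gt_atTop 0] with n hn
    simp only [Pi.div_apply]
    rw [div_div_div_cancel_right₀ (by positivity)]
  · filter_upwards [eventually_ge_atTop 0] with T hT
    obtain ⟨h1, h2⟩ := lastUpdate_spec hS T.toNNReal
    have h1' : ((updateTime Y (lastUpdate Y T.toNNReal ω) ω : ℝ≥0) : ℝ) ≤ T := by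
      exact (NNReal.coe_le_coe.2 h1).trans_eq (Real.coe_toNNReal T hT)
    have h2' : T ≤ updateTime Y (lastUpdate Y T.toNNReal ω + 1) ω := by
      exact (Real.coe_toNNReal T hT).symm.trans_le (NNReal.coe_le_coe.2 h2.le)
    refine ⟨h1', h2', ?_, ?_⟩
    · rw [← integral_cached_idle_updateTime c hS]
      exact integral_cached_idle_mono c hS h1'
    · rw [← integral_cached_idle_updateTime c hS]
      exact integral_cached_idle_mono c hS h2'

end CachedFraction

/-! ### Arrival times and their counting function -/

section TaskCount

theorem measurable_taskCount {Ω : Type*} [MeasurableSpace Ω] {τ : ℕ → Ω → ℝ≥0}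
    (hτ : ∀ n, Measurable (τ n)) {keep : ℕ → Ω → Prop} (hk : ∀ n, MeasurableSet {ω | keep n ω})
    (t : ℝ≥0) : Measurable (taskCount τ keep t) :=
  measurable_ncard.comp (measurable_set_iff.2 fun n =>
    measurableSet_setOfPred.1 ((measurableSet_le (hτ n) measurable_const).inter (hk n)))

variable {Ω : Type*} {τ : ℕ → Ω → ℝ≥0} {ω : Ω}

/-- The arrivals up to time t occupy an initial segment of indices, finite because the arrival times
diverge. -/
theorem lt_taskCount_iff (hm : StrictMono fun n => τ n ω)
    (ht : Tendsto (fun n => τ n ω) atTop atTop) (n : ℕ) (t : ℝ≥0) :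
    n < taskCount τ (fun _ _ => True) t ω ↔ τ n ω ≤ t := by
  classical
  have hex : ∃ n, t < τ n ω := (ht.eventually_gt_atTop t).exists
  have hset : {n | τ n ω ≤ t ∧ True} = ((Finset.range (Nat.find hex) : Finset ℕ) : Set ℕ) := by
    ext k
    simp only [and_true, Set.mem_ofPred_eq, Finset.coe_range, Set.mem_Iio]
    constructor
    · intro hk
      exact hm.lt_iff_lt.1 (hk.trans_lt (Nat.find_spec hex))
    · intro hk
      exact not_lt.1 (Nat.find_min hex hk)
  have hmem : τ n ω ≤ t ↔ n ∈ {n | τ n ω ≤ t ∧ True} := by simp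
  rw [hmem, hset, taskCount, hset, Set.ncard_coe_finset, Finset.card_range]
  simp

theorem taskCount_eq_card (hm : StrictMono fun n => τ n ω)
    (ht : Tendsto (fun n => τ n ω) atTop atTop) (keep : ℕ → Ω → Prop)
    [∀ n, Decidable (keep n ω)] (t : ℝ≥0) :
    taskCount τ keep t ω
      = ((Finset.range (taskCount τ (fun _ _ => True) t ω)).filter fun n => keep n ω).card := by
  rw [taskCount, ← Set.ncard_coe_finset]
  congr 1
  ext n
  simp [lt_taskCount_iff hm ht]

end TaskCount

/-! ### Stieltjes and Riemann sums over cells -/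

section GridSum

/-- The `i`-th point of the partition of `[0, t]` into `m + 1` cells of equal length. -/
noncomputable def cellPoint (t : ℝ≥0) (m i : ℕ) : ℝ≥0 := i * (t / (m + 1))

theorem cellPoint_mono (t : ℝ≥0) (m : ℕ) : Monotone (cellPoint t m) := fun i j h => by
  unfold cellPoint; gcongr

theorem cellPoint_zero (t : ℝ≥0) (m : ℕ) : cellPoint t m 0 = 0 := by simp [cellPoint]

theorem cellPoint_last (t : ℝ≥0) (m : ℕ) : cellPoint t m (m + 1) = t := by
  unfold cellPoint
  push_cast
  rw [mul_div_cancel₀]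
  positivity

theorem cellPoint_succ (t : ℝ≥0) (m i : ℕ) :
    cellPoint t m (i + 1) = cellPoint t m i + t / (m + 1) := by
  unfold cellPoint; push_cast; ring

theorem tendsto_cell_length (t : ℝ≥0) : Tendsto (fun m : ℕ => t / ((m : ℝ≥0) + 1)) atTop (𝓝 0) := by
  have := (tendsto_const_nhds (x := t)).mul tendsto_one_div_add_one_nnreal
  rw [mul_zero] at this
  refine this.congr fun m => ?_
  rw [mul_one_div]

theorem cast_sub_eq_sum_ite {s : ℕ → ℝ≥0} {N : ℝ≥0 → ℕ} (hN : ∀ n u, n < N u ↔ s n ≤ u)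
    {a b t : ℝ≥0} (hbt : b ≤ t) : ((N b - N a : ℕ) : ℝ)
      = ∑ n ∈ Finset.range (N t), if a < s n ∧ s n ≤ b then (1 : ℝ) else 0 := by
  rw [Finset.sum_boole, ← Nat.card_Ico]
  congr 2
  ext n
  simp only [Finset.mem_Ico, Finset.mem_filter, Finset.mem_range, hN, ← not_lt (b := N a)]
  constructor
  · rintro ⟨h1, h2⟩
    exact ⟨h2.trans hbt, not_le.1 h1, h2⟩
  · rintro ⟨-, h1, h2⟩
    exact ⟨not_le.2 h1, h2⟩

/-- Sampling a right-locally-constant function at the points of a locally finite sequence agrees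
with the Stieltjes sums against the counting function over fine enough partitions. -/
theorem eventually_cellSum_eq {g : ℝ≥0 → ℝ} (hg : ∀ u, ∀ᶠ v in 𝓝[≥] u, g v = g u)
    {s : ℕ → ℝ≥0} {N : ℝ≥0 → ℕ} (hN : ∀ n u, n < N u ↔ s n ≤ u) (h0 : N 0 = 0) (t : ℝ≥0) :
    ∀ᶠ m in atTop, ∑ i ∈ Finset.range (m + 1), g (cellPoint t m (i + 1)) *
      ((N (cellPoint t m (i + 1)) - N (cellPoint t m i) : ℕ) : ℝ)
        = ∑ n ∈ Finset.range (N t), g (s n) := by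
  -- Once the mesh is fine enough, `g` is constant from `s n` to the right end of its cell; only
  -- finitely many points lie in [0, t], so one mesh serves them all.
  have hcell : ∀ n, ∀ᶠ m : ℕ in atTop, ∀ v, s n ≤ v → v ≤ s n + t / (m + 1) → g v = g (s n) := by
    intro n
    obtain ⟨ε, hε, hball⟩ := Metric.mem_nhdsWithin_iff.1 (hg (s n))
    have hlen := NNReal.tendsto_coe.2 (tendsto_cell_length t)
    filter_upwards [hlen.eventually_lt_const (by simpa using hε)] with m hm v hv1 hv2
    refine hball ⟨?_, hv1⟩
    rw [Metric.mem_ball, NNReal.dist_eq, abs_of_nonneg (sub_nonneg.2 (NNReal.coe_le_coe.2 hv1))]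
    have : (v : ℝ) ≤ s n + ((t / ((m : ℝ≥0) + 1) : ℝ≥0) : ℝ) := by exact_mod_cast hv2
    linarith
  have hall : ∀ᶠ m : ℕ in atTop, ∀ n ∈ Finset.range (N t),
      ∀ v, s n ≤ v → v ≤ s n + t / (m + 1) → g v = g (s n) :=
    (Filter.eventually_all_finset _).2 fun n _ => hcell n
  filter_upwards [hall] with m hm
  have h1 : ∀ i ∈ Finset.range (m + 1), g (cellPoint t m (i + 1)) *
      ((N (cellPoint t m (i + 1)) - N (cellPoint t m i) : ℕ) : ℝ)
      = ∑ n ∈ Finset.range (N t), g (s n) *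
        ((if s n ≤ cellPoint t m (i + 1) then (1 : ℝ) else 0)
          - if s n ≤ cellPoint t m i then 1 else 0) := by
    intro i hi
    have hbt : cellPoint t m (i + 1) ≤ t := by
      conv_rhs => rw [← cellPoint_last t m]
      exact cellPoint_mono t m (Finset.mem_range.1 hi)
    have hab : cellPoint t m i ≤ cellPoint t m (i + 1) := cellPoint_mono t m i.le_succ
    rw [cast_sub_eq_sum_ite hN hbt, Finset.mul_sum]
    refine Finset.sum_congr rfl fun n hn => ?_
    by_cases ha : s n ≤ cellPoint t m i
    · simp [ha, ha.trans hab, not_lt.2 ha]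
    · by_cases hb : s n ≤ cellPoint t m (i + 1)
      · have : g (cellPoint t m (i + 1)) = g (s n) := by
          refine hm n hn _ hb ?_
          rw [cellPoint_succ]
          gcongr
          exact (not_le.1 ha).le
        simp [ha, hb, not_le.1 ha, this]
      · simp [ha, hb]
  rw [Finset.sum_congr rfl h1, Finset.sum_comm]
  refine Finset.sum_congr rfl fun n hn => ?_
  -- The cell indicators of a fixed point telescope to 1, because 0 < s n ≤ t; `h0` excludes a point
  -- at 0.
  rw [← Finset.mul_sum, Finset.sum_range_sub (fun i => if s n ≤ cellPoint t m i then (1 : ℝ) else 0),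
    cellPoint_last, cellPoint_zero, if_pos ((hN n t).1 (Finset.mem_range.1 hn)), if_neg, sub_zero,
    mul_one]
  rw [← hN, h0]
  exact Nat.not_lt_zero n

/-- Convergence of right-endpoint Riemann sums for right-continuous bounded functions. -/
theorem tendsto_cell_riemann {g : ℝ≥0 → ℝ} (hg : ∀ u, ∀ᶠ v in 𝓝[≥] u, g v = g u)
    (hm : Measurable g) (hb : ∀ u, |g u| ≤ 1) (t : ℝ≥0) :
    Tendsto (fun m : ℕ => ∑ i ∈ Finset.range (m + 1), g (cellPoint t m (i + 1)) *
      ((t : ℝ) / (m + 1))) atTop (𝓝 (∫ u in (0 : ℝ)..t, g u.toNNReal)) := by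
  rcases eq_or_ne t 0 with rfl | ht
  · simp
  have hh : ∀ m : ℕ, 0 < t / ((m : ℝ≥0) + 1) := fun m => by
    have := pos_iff_ne_zero.2 ht
    positivity
  -- `e m u` is the right endpoint of the cell containing `u`, so the Riemann sum is exactly the
  -- integral of `g ∘ e m`.
  set e : ℕ → ℝ → ℝ≥0 := fun m u => ⌈u.toNNReal / (t / ((m : ℝ≥0) + 1))⌉₊ * (t / ((m : ℝ≥0) + 1))
    with he
  have hem : ∀ m, Measurable (e m) := fun m => by
    have h1 : Measurable fun u : ℝ => ⌈u.toNNReal / (t / ((m : ℝ≥0) + 1))⌉₊ :=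
      Nat.measurable_ceil.comp (measurable_real_toNNReal.div_const _)
    exact ((Measurable.of_discrete (f := fun n : ℕ => (n : ℝ≥0))).comp h1).mul_const _
  have hge : ∀ m u, u.toNNReal ≤ e m u := fun m u => by
    rw [he]
    exact (div_le_iff₀ (hh m)).1 (Nat.le_ceil _)
  have hle : ∀ m u, e m u ≤ u.toNNReal + t / ((m : ℝ≥0) + 1) := fun m u => by
    have h1 := (Nat.ceil_lt_add_one (zero_le (a := u.toNNReal / (t / ((m : ℝ≥0) + 1))))).le
    calc e m u ≤ (u.toNNReal / (t / ((m : ℝ≥0) + 1)) + 1) * (t / ((m : ℝ≥0) + 1)) :=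
          mul_le_mul_left h1 _
      _ = _ := by rw [add_mul, div_mul_cancel₀ _ (hh m).ne', one_mul]
  have hint : ∀ m : ℕ, ∀ a b : ℝ, IntervalIntegrable (fun u => g (e m u)) volume a b := by
    intro m a b
    rw [intervalIntegrable_iff]
    exact Measure.integrableOn_of_bounded (M := 1) measure_Ioc_lt_top.ne
      (hm.comp (hem m)).aestronglyMeasurable (.of_forall fun u => hb _)
  have hsum : ∀ m : ℕ, ∑ i ∈ Finset.range (m + 1), g (cellPoint t m (i + 1)) * ((t : ℝ) / (m + 1))
      = ∫ u in (0 : ℝ)..t, g (e m u) := by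
    intro m
    have e0 : ((cellPoint t m 0 : ℝ≥0) : ℝ) = 0 := by rw [cellPoint_zero]; rfl
    have e1 : ((cellPoint t m (m + 1) : ℝ≥0) : ℝ) = t := by rw [cellPoint_last]
    rw [← e0, ← e1, ← intervalIntegral.sum_integral_adjacent_intervals
      (a := fun n => ((cellPoint t m n : ℝ≥0) : ℝ)) fun k _ => hint m _ _, e1]
    refine Finset.sum_congr rfl fun i _ => ?_
    have hlei : ((cellPoint t m i : ℝ≥0) : ℝ) ≤ cellPoint t m (i + 1) :=
      cellPoint_mono t m i.le_succ
    rw [intervalIntegral.integral_congr_Ioo_of_le (g := fun _ => g (cellPoint t m (i + 1))) hlei]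
    · rw [intervalIntegral.integral_const, smul_eq_mul, mul_comm, cellPoint_succ]
      push_cast
      ring
    · intro u hu
      dsimp only
      congr 1
      have hu0 : 0 ≤ u := (NNReal.coe_nonneg _).trans hu.1.le
      have hu1 : cellPoint t m i < u.toNNReal := Real.lt_toNNReal_iff_coe_lt.2 hu.1
      have hu2 : u.toNNReal < cellPoint t m (i + 1) := (Real.toNNReal_lt_iff_lt_coe hu0).2 hu.2
      have : ⌈u.toNNReal / (t / ((m : ℝ≥0) + 1))⌉₊ = i + 1 := by
        rw [Nat.ceil_eq_iff (by omega)]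
        constructor
        · rw [lt_div_iff₀ (hh m)]; exact hu1
        · rw [div_le_iff₀ (hh m)]; exact hu2.le
      rw [he]
      dsimp only
      rw [this]
      rfl
  simp_rw [hsum]
  refine intervalIntegral.tendsto_integral_filter_of_dominated_convergence (fun _ => 1)
    (.of_forall fun m => (hm.comp (hem m)).aestronglyMeasurable)
    (.of_forall fun m => .of_forall fun u _ => hb _) intervalIntegrable_const
    (.of_forall fun u _ => ?_)
  have hlim : Tendsto (fun m => e m u) atTop (𝓝[≥] u.toNNReal) := by
    refine tendsto_nhdsWithin_iff.2 ⟨?_, .of_forall fun m => hge m u⟩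
    have h1 := (tendsto_const_nhds (x := u.toNNReal)).add (tendsto_cell_length t)
    rw [add_zero] at h1
    exact tendsto_of_tendsto_of_tendsto_of_le_of_le tendsto_const_nhds h1 (fun m => hge m u)
      (fun m => hle m u)
  refine tendsto_const_nhds.congr' ?_
  filter_upwards [hlim.eventually (hg u.toNNReal)] with m hm'
  exact hm'.symm

end GridSum

/-! ### Moments of the Poisson law -/

section PoissonMoments

/-- The Poisson weights satisfy n p(n) = r p(n - 1), so the series is a shift of the total mass; the
second moment reduces to the first in the same way. -/
theorem hasSum_poisson_mul (r : ℝ≥0) :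
    HasSum (fun n : ℕ => Real.exp (-r) * r ^ n / n ! * (n : ℝ)) r := by
  have h := (hasSum_one_poissonMeasure r).mul_left (r : ℝ)
  rw [mul_one] at h
  have h2 := (hasSum_nat_add_iff (f := fun n : ℕ => Real.exp (-r) * r ^ n / n ! * (n : ℝ)) 1).1
    (h.congr_fun fun n => ?_)
  · simpa using h2
  · rw [Nat.factorial_succ]
    push_cast
    field_simp
    ring

theorem hasSum_poisson_mul_sq (r : ℝ≥0) :
    HasSum (fun n : ℕ => Real.exp (-r) * r ^ n / n ! * (n : ℝ) ^ 2) ((r : ℝ) ^ 2 + r) := by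
  have h := ((hasSum_poisson_mul r).add (hasSum_one_poissonMeasure r)).mul_left (r : ℝ)
  have h2 := (hasSum_nat_add_iff (f := fun n : ℕ => Real.exp (-r) * r ^ n / n ! * (n : ℝ) ^ 2) 1).1
    (h.congr_fun fun n => ?_)
  · have e : (r : ℝ) * (r + 1) = (r : ℝ) ^ 2 + r := by ring
    simpa [e] using h2
  · rw [Nat.factorial_succ]
    push_cast
    field_simp
    ring

theorem integrable_natCast_poissonMeasure (r : ℝ≥0) :
    Integrable (fun n : ℕ => (n : ℝ)) (poissonMeasure r) :=
  integrable_poissonMeasure_iff.2 (by simpa using (hasSum_poisson_mul r).summable)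

theorem integrable_natCast_sq_poissonMeasure (r : ℝ≥0) :
    Integrable (fun n : ℕ => (n : ℝ) ^ 2) (poissonMeasure r) :=
  integrable_poissonMeasure_iff.2 (by simpa using (hasSum_poisson_mul_sq r).summable)

theorem integral_natCast_poissonMeasure (r : ℝ≥0) : ∫ n : ℕ, (n : ℝ) ∂(poissonMeasure r) = r := by
  rw [integral_poissonMeasure]
  simpa using (hasSum_poisson_mul r).tsum_eq

theorem integral_natCast_sub_sq_poissonMeasure (r : ℝ≥0) :
    ∫ n : ℕ, ((n : ℝ) - r) ^ 2 ∂(poissonMeasure r) = r := by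
  have h2 : ∫ n : ℕ, (n : ℝ) ^ 2 ∂(poissonMeasure r) = (r : ℝ) ^ 2 + r := by
    rw [integral_poissonMeasure]
    simpa using (hasSum_poisson_mul_sq r).tsum_eq
  have e : ∀ n : ℕ, ((n : ℝ) - r) ^ 2 = ((n : ℝ) ^ 2 - 2 * r * n) + (r : ℝ) ^ 2 := fun n => by ring
  have hi := (integrable_natCast_poissonMeasure r).const_mul (2 * (r : ℝ))
  simp_rw [e]
  rw [integral_add (by exact (integrable_natCast_sq_poissonMeasure r).sub hi) (integrable_const _),
    integral_sub (integrable_natCast_sq_poissonMeasure r) hi, integral_const_mul, h2,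
    integral_natCast_poissonMeasure]
  simp
  ring

end PoissonMoments

/-! ### Cell sums against Poisson arrivals -/

section Arrivals

variable {Ω : Type*} [MeasurableSpace Ω] {P : Measure Ω} [IsProbabilityMeasure P]
  {N : ℝ≥0 → Ω → ℕ} {r : ℝ}

theorem IsPoissonCounting.integrable_increment (hN : IsPoissonCounting N r P) {s t : ℝ≥0}
    (hst : s ≤ t) : Integrable (fun ω => ((N t ω - N s ω : ℕ) : ℝ)) P := by
  have hm : Measurable fun ω => N t ω - N s ω := (hN.measurable t).sub (hN.measurable s)
  have h := integrable_natCast_poissonMeasure (r * ((t : ℝ) - (s : ℝ))).toNNReal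
  rw [← hN.increments s t hst] at h
  exact h.comp_measurable hm

theorem IsPoissonCounting.integral_increment (hN : IsPoissonCounting N r P) (hr : 0 < r)
    {s t : ℝ≥0} (hst : s ≤ t) : ∫ ω, ((N t ω - N s ω : ℕ) : ℝ) ∂P = r * ((t : ℝ) - s) := by
  have hm : Measurable fun ω => N t ω - N s ω := (hN.measurable t).sub (hN.measurable s)
  have h := integral_natCast_poissonMeasure (r * ((t : ℝ) - (s : ℝ))).toNNReal
  rw [← hN.increments s t hst, integral_map hm.aemeasurable (by fun_prop), Real.coe_toNNReal] at h
  · exact h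
  · exact mul_nonneg hr.le (sub_nonneg.2 (NNReal.coe_le_coe.2 hst))

theorem IsPoissonCounting.memLp_increment (hN : IsPoissonCounting N r P) {s t : ℝ≥0}
    (hst : s ≤ t) : MemLp (fun ω => ((N t ω - N s ω : ℕ) : ℝ)) 2 P := by
  have hm : Measurable fun ω => N t ω - N s ω := (hN.measurable t).sub (hN.measurable s)
  have h := integrable_natCast_sq_poissonMeasure (r * ((t : ℝ) - (s : ℝ))).toNNReal
  rw [← hN.increments s t hst] at h
  refine (memLp_two_iff_integrable_sq ?_).2 (h.comp_measurable hm)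
  exact ((Measurable.of_discrete (f := fun n : ℕ => (n : ℝ))).comp hm).aestronglyMeasurable

theorem IsPoissonCounting.integral_sq_increment (hN : IsPoissonCounting N r P) (hr : 0 < r)
    {s t : ℝ≥0} (hst : s ≤ t) :
    ∫ ω, (((N t ω - N s ω : ℕ) : ℝ) - r * ((t : ℝ) - s)) ^ 2 ∂P = r * ((t : ℝ) - s) := by
  have hm : Measurable fun ω => N t ω - N s ω := (hN.measurable t).sub (hN.measurable s)
  have h := integral_natCast_sub_sq_poissonMeasure (r * ((t : ℝ) - (s : ℝ))).toNNReal
  rw [← hN.increments s t hst, integral_map hm.aemeasurable (by fun_prop), Real.coe_toNNReal] at h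
  · exact h
  · exact mul_nonneg hr.le (sub_nonneg.2 (NNReal.coe_le_coe.2 hst))

variable {τ : ℕ → Ω → ℝ≥0} {χ : ℝ≥0 → Ω → ℝ}

/-- The Stieltjes sum of `χ` against the arrivals over the cells of `[0, t]`. -/
noncomputable def cellSum (τ : ℕ → Ω → ℝ≥0) (χ : ℝ≥0 → Ω → ℝ) (t : ℝ≥0) (m : ℕ) (ω : Ω) : ℝ :=
  ∑ i ∈ Finset.range (m + 1), χ (cellPoint t m (i + 1)) ω *
    ((taskCount τ (fun _ _ => True) (cellPoint t m (i + 1)) ω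
      - taskCount τ (fun _ _ => True) (cellPoint t m i) ω : ℕ) : ℝ)

/-- Counts are measurable functionals of the arrival sequence. Two times and two increments are
allowed so that the cross terms of second moments are covered; means use dummy arguments. -/
theorem indepFun_taskCount_increments
    (hind : IndepFun (fun ω n => τ n ω) (fun ω t => χ t ω) P)
    {f : ℝ → ℝ → ℝ} (hf : Measurable fun p : ℝ × ℝ => f p.1 p.2)
    {g : ℕ → ℕ → ℝ} (u v a b a' b' : ℝ≥0) :
    IndepFun (fun ω => f (χ u ω) (χ v ω)) (fun ω => g
      (taskCount τ (fun _ _ => True) b ω - taskCount τ (fun _ _ => True) a ω)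
      (taskCount τ (fun _ _ => True) b' ω - taskCount τ (fun _ _ => True) a' ω)) P := by
  have hcount : ∀ t, Measurable
      (taskCount (Ω := ℕ → ℝ≥0) (fun n s => s n) (fun _ _ => True) t) := fun t =>
    measurable_taskCount (fun n => measurable_pi_apply n) (fun _ => MeasurableSet.univ) t
  have h1 : Measurable fun x : ℝ≥0 → ℝ => f (x u) (x v) :=
    hf.comp (f := fun x : ℝ≥0 → ℝ => (x u, x v))
      ((measurable_pi_apply u).prodMk (measurable_pi_apply v))
  have h2 : Measurable fun s : ℕ → ℝ≥0 => g
      (taskCount (fun n (s : ℕ → ℝ≥0) => s n) (fun _ _ => True) b s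
        - taskCount (fun n (s : ℕ → ℝ≥0) => s n) (fun _ _ => True) a s)
      (taskCount (fun n (s : ℕ → ℝ≥0) => s n) (fun _ _ => True) b' s
        - taskCount (fun n (s : ℕ → ℝ≥0) => s n) (fun _ _ => True) a' s) :=
    (Measurable.of_discrete (f := fun p : ℕ × ℕ => g p.1 p.2)).comp
      (((hcount b).sub (hcount a)).prodMk ((hcount b').sub (hcount a')))
  exact hind.symm.comp h1 h2

theorem IsPoissonArrivals.measurable_count (hτ : IsPoissonArrivals τ r P) (t : ℝ≥0) :
    Measurable (taskCount τ (fun _ _ => True) t) := hτ.counting.measurable t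

theorem IsPoissonArrivals.measurable_cellSum (hτ : IsPoissonArrivals τ r P)
    (hχ : ∀ t, Measurable (χ t)) (t : ℝ≥0) (m : ℕ) : Measurable (cellSum τ χ t m) :=
  Finset.measurable_sum _ fun _ _ => (hχ _).mul
    ((Measurable.of_discrete (f := fun n : ℕ => (n : ℝ))).comp
      ((hτ.measurable_count _).sub (hτ.measurable_count _)))

theorem cell_length (t : ℝ≥0) (m i : ℕ) :
    ((cellPoint t m (i + 1) : ℝ≥0) : ℝ) - cellPoint t m i = (t : ℝ) / (m + 1) := by
  rw [cellPoint_succ]; push_cast; ring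

theorem IsPoissonArrivals.integral_cellSum (hτ : IsPoissonArrivals τ r P) (hr : 0 < r)
    (hχ : ∀ t, Measurable (χ t)) (hχ1 : ∀ t ω, |χ t ω| ≤ 1)
    (hind : IndepFun (fun ω n => τ n ω) (fun ω t => χ t ω) P) {p : ℝ}
    (hp : ∀ t, ∫ ω, χ t ω ∂P = p) (t : ℝ≥0) (m : ℕ) :
    ∫ ω, cellSum τ χ t m ω ∂P = r * p * t := by
  have hmono := cellPoint_mono t m
  unfold cellSum
  rw [integral_finsetSum]
  · have e : ∀ i ∈ Finset.range (m + 1), ∫ ω, χ (cellPoint t m (i + 1)) ω *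
        ((taskCount τ (fun _ _ => True) (cellPoint t m (i + 1)) ω
          - taskCount τ (fun _ _ => True) (cellPoint t m i) ω : ℕ) : ℝ) ∂P
        = p * (r * ((t : ℝ) / (m + 1))) := by
      intro i _
      have hi := indepFun_taskCount_increments hind (f := fun x _ => x) measurable_fst
        (g := fun n _ => (n : ℝ)) (cellPoint t m (i + 1)) 0 (cellPoint t m i)
        (cellPoint t m (i + 1)) 0 0
      rw [hi.integral_fun_mul_eq_mul_integral (hχ _).aestronglyMeasurable
        (hτ.counting.integrable_increment (hmono i.le_succ)).aestronglyMeasurable, hp,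
        hτ.counting.integral_increment hr (hmono i.le_succ), cell_length]
    rw [Finset.sum_congr rfl e, Finset.sum_const, Finset.card_range, nsmul_eq_mul]
    push_cast
    field_simp
  · intro i _
    exact (hτ.counting.integrable_increment (hmono i.le_succ)).bdd_mul
      (hχ _).aestronglyMeasurable (.of_forall fun ω => hχ1 _ ω)

/-- Independence of the arrivals from all of χ factors each product term, and centred increments
over distinct cells are orthogonal. Only the diagonal remains, with variance r times the cell length
and weight at most 1, so the bound does not depend on the mesh. -/
theorem IsPoissonArrivals.integral_sq_cellSum_le (hτ : IsPoissonArrivals τ r P) (hr : 0 < r)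
    (hχ : ∀ t, Measurable (χ t)) (hχ1 : ∀ t ω, |χ t ω| ≤ 1)
    (hind : IndepFun (fun ω n => τ n ω) (fun ω t => χ t ω) P) (t : ℝ≥0) (m : ℕ) :
    Integrable (fun ω => (cellSum τ χ t m ω - r * ∑ i ∈ Finset.range (m + 1),
      χ (cellPoint t m (i + 1)) ω * ((t : ℝ) / (m + 1))) ^ 2) P ∧
    ∫ ω, (cellSum τ χ t m ω - r * ∑ i ∈ Finset.range (m + 1),
      χ (cellPoint t m (i + 1)) ω * ((t : ℝ) / (m + 1))) ^ 2 ∂P ≤ r * t := by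
  have hmono := cellPoint_mono t m
  set h : ℝ := (t : ℝ) / (m + 1) with hh
  set a : ℕ → Ω → ℝ := fun i ω => χ (cellPoint t m (i + 1)) ω with ha
  set b : ℕ → Ω → ℝ := fun i ω => ((taskCount τ (fun _ _ => True) (cellPoint t m (i + 1)) ω
      - taskCount τ (fun _ _ => True) (cellPoint t m i) ω : ℕ) : ℝ) - r * h with hb
  have hbL : ∀ i, MemLp (b i) 2 P := fun i =>
    (hτ.counting.memLp_increment (hmono i.le_succ)).sub (memLp_const _)
  have hb0 : ∀ i, ∫ ω, b i ω ∂P = 0 := fun i => by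
    rw [hb]
    dsimp only
    rw [integral_sub (hτ.counting.integrable_increment (hmono i.le_succ)) (integrable_const _),
      hτ.counting.integral_increment hr (hmono i.le_succ), cell_length]
    simp [hh]
  have hb2 : ∀ i, ∫ ω, b i ω * b i ω ∂P = r * h := fun i => by
    have := hτ.counting.integral_sq_increment hr (hmono i.le_succ)
    rw [cell_length] at this
    simpa only [hb, ← sq] using this
  have hbi : ∀ i j, i ≠ j → ∫ ω, b i ω * b j ω ∂P = 0 := by
    intro i j hij
    have h1 := (hτ.counting.indepIncrements.nat hmono).indepFun hij
    have hm : Measurable fun n : ℕ => (n : ℝ) - r * h := Measurable.of_discrete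
    have h2 := h1.comp hm hm
    have h3 := h2.integral_fun_mul_eq_mul_integral (hbL i).aestronglyMeasurable
      (hbL j).aestronglyMeasurable
    have h4 : ∫ ω, b i ω * b j ω ∂P = (∫ ω, b i ω ∂P) * ∫ ω, b j ω ∂P := h3
    rw [h4, hb0, zero_mul]
  have hbb : ∀ i j, Integrable (fun ω => b i ω * b j ω) P := fun i j =>
    (hbL i).integrable_mul (hbL j)
  have haam : ∀ i j, Measurable fun ω => a i ω * a j ω := fun i j => (hχ _).mul (hχ _)
  have haa1 : ∀ i j ω, |a i ω * a j ω| ≤ 1 := fun i j ω => by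
    rw [abs_mul]; exact mul_le_one₀ (hχ1 _ ω) (abs_nonneg _) (hχ1 _ ω)
  have hI : ∀ i j, Integrable (fun ω => (a i ω * a j ω) * (b i ω * b j ω)) P := fun i j =>
    (hbb i j).bdd_mul (haam i j).aestronglyMeasurable (.of_forall fun ω => haa1 i j ω)
  have hE : ∀ i j, ∫ ω, (a i ω * a j ω) * (b i ω * b j ω) ∂P
      = (∫ ω, a i ω * a j ω ∂P) * ∫ ω, b i ω * b j ω ∂P := fun i j => by
    have hi := indepFun_taskCount_increments hind (f := fun x y => x * y)
      (measurable_fst.mul measurable_snd)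
      (g := fun n k => ((n : ℝ) - r * h) * ((k : ℝ) - r * h)) (cellPoint t m (i + 1))
      (cellPoint t m (j + 1)) (cellPoint t m i) (cellPoint t m (i + 1)) (cellPoint t m j)
      (cellPoint t m (j + 1))
    exact hi.integral_fun_mul_eq_mul_integral (haam i j).aestronglyMeasurable
      (hbb i j).aestronglyMeasurable
  have e : ∀ ω, (cellSum τ χ t m ω - r * ∑ i ∈ Finset.range (m + 1),
      χ (cellPoint t m (i + 1)) ω * h) ^ 2
      = ∑ i ∈ Finset.range (m + 1), ∑ j ∈ Finset.range (m + 1),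
        (a i ω * a j ω) * (b i ω * b j ω) := by
    intro ω
    have : cellSum τ χ t m ω - r * ∑ i ∈ Finset.range (m + 1), χ (cellPoint t m (i + 1)) ω * h
        = ∑ i ∈ Finset.range (m + 1), a i ω * b i ω := by
      rw [cellSum, Finset.mul_sum, ← Finset.sum_sub_distrib]
      refine Finset.sum_congr rfl fun i _ => ?_
      simp only [ha, hb]
      ring
    rw [this, sq, Finset.sum_mul_sum]
    exact Finset.sum_congr rfl fun i _ => Finset.sum_congr rfl fun j _ => by ring
  simp_rw [e]
  refine ⟨integrable_finsetSum _ fun i _ => integrable_finsetSum _ fun j _ => hI i j, ?_⟩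
  rw [integral_finsetSum _ fun i _ => integrable_finsetSum _ fun j _ => hI i j]
  have hrow : ∀ i ∈ Finset.range (m + 1), ∫ ω, ∑ j ∈ Finset.range (m + 1),
      (a i ω * a j ω) * (b i ω * b j ω) ∂P ≤ r * h := by
    intro i hi
    rw [integral_finsetSum _ fun j _ => hI i j, Finset.sum_eq_single i]
    · rw [hE, hb2]
      have h1 : ∫ ω, a i ω * a i ω ∂P ≤ 1 := by
        refine (integral_mono_of_nonneg (.of_forall fun ω => mul_self_nonneg _)
          (integrable_const 1) (.of_forall fun ω => (le_abs_self _).trans (haa1 i i ω))).trans ?_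
        simp
      have h0 : 0 ≤ r * h := by positivity
      exact mul_le_of_le_one_left h0 h1
    · intro j _ hj
      rw [hE, hbi i j hj.symm, mul_zero]
    · exact fun h => absurd hi h
  refine (Finset.sum_le_sum hrow).trans ?_
  rw [Finset.sum_const, Finset.card_range, nsmul_eq_mul, hh]
  push_cast
  apply le_of_eq
  field_simp

end Arrivals

/-! ### Mean and long-run rate of the forwarded tasks -/

section Forwarding

/-- Fatou's lemma, which carries the mesh-free second-moment bound over to the limit. -/
theorem integral_le_of_ae_tendsto {Ω : Type*} [MeasurableSpace Ω] {P : Measure Ω}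
    {f : ℕ → Ω → ℝ} {g : Ω → ℝ} {K : ℝ} (hK : 0 ≤ K) (h0 : ∀ m ω, 0 ≤ f m ω)
    (hint : ∀ m, Integrable (f m) P) (hle : ∀ m, ∫ ω, f m ω ∂P ≤ K)
    (hlim : ∀ᵐ ω ∂P, Tendsto (fun m => f m ω) atTop (𝓝 (g ω))) :
    Integrable g P ∧ ∫ ω, g ω ∂P ≤ K := by
  have hg0 : 0 ≤ᵐ[P] g := by
    filter_upwards [hlim] with ω hω using ge_of_tendsto' hω fun m => h0 m ω
  have hgm : AEStronglyMeasurable g P :=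
    aestronglyMeasurable_of_tendsto_ae atTop (fun m => (hint m).aestronglyMeasurable) hlim
  have hl : ∫⁻ ω, ENNReal.ofReal (g ω) ∂P ≤ ENNReal.ofReal K := by
    have h1 : ∫⁻ ω, ENNReal.ofReal (g ω) ∂P
        = ∫⁻ ω, liminf (fun m => ENNReal.ofReal (f m ω)) atTop ∂P := by
      refine lintegral_congr_ae ?_
      filter_upwards [hlim] with ω hω
      exact ((ENNReal.continuous_ofReal.tendsto _).comp hω).liminf_eq.symm
    rw [h1]
    refine (lintegral_liminf_le' fun m => (hint m).aemeasurable.ennreal_ofReal).trans ?_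
    refine (liminf_le_liminf (.of_forall fun m => ?_)).trans_eq
      (liminf_const (f := (atTop : Filter ℕ)) (ENNReal.ofReal K))
    rw [← ofReal_integral_eq_lintegral_ofReal (hint m) (.of_forall (h0 m))]
    exact ENNReal.ofReal_le_ofReal (hle m)
  refine ⟨⟨hgm, ?_⟩, ?_⟩
  · rw [hasFiniteIntegral_iff_ofReal hg0]
    exact hl.trans_lt ENNReal.ofReal_lt_top
  · rw [integral_eq_lintegral_of_nonneg_ae hg0 hgm]
    exact ENNReal.toReal_le_of_le_ofReal hK hl

theorem forwardedCount_eq_sum {Ω : Type*} {C : ℕ} (c : ℝ≥0 → Ω → Fin (C + 1))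
    (Y : ℕ → Ω → ℝ≥0) {τ : ℕ → Ω → ℝ≥0} {ω : Ω} (hm : StrictMono fun n => τ n ω)
    (ht : Tendsto (fun n => τ n ω) atTop atTop) (t : ℝ≥0) :
    (forwardedCount c Y τ t ω : ℝ) = ∑ n ∈ Finset.range (taskCount τ (fun _ _ => True) t ω),
      idleIndicator (cachedState c Y (τ n ω) ω) := by
  rw [forwardedCount, taskCount_eq_card hm ht, ← Finset.sum_boole]
  rfl

theorem taskCount_mono {Ω : Type*} {τ : ℕ → Ω → ℝ≥0} {ω : Ω}
    (ht : Tendsto (fun n => τ n ω) atTop atTop) (keep : ℕ → Ω → Prop) :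
    Monotone fun t => taskCount τ keep t ω := by
  intro s t hst
  refine Set.ncard_le_ncard (fun n hn => ⟨hn.1.trans hst, hn.2⟩) ?_
  obtain ⟨n0, hn0⟩ := eventually_atTop.1 (ht.eventually_gt_atTop t)
  refine (Set.finite_Iio n0).subset fun n hn => ?_
  by_contra h
  exact (hn0 n (not_lt.1 h)).not_ge hn.1

variable {Ω : Type*} [MeasurableSpace Ω] {P : Measure Ω} [IsProbabilityMeasure P]
  {C : ℕ} {lam μ lamIn r p : ℝ} {c : ℝ≥0 → Ω → Fin (C + 1)} {Y : ℕ → Ω → ℝ≥0}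
  {τ : ℕ → Ω → ℝ≥0}

theorem IsPoissonArrivals.ae_eventually_cellSum_eq (hτ : IsPoissonArrivals τ lamIn P)
    (hS : ∀ᵐ ω ∂P, Tendsto (fun n => updateTime Y n ω) atTop atTop) :
    ∀ᵐ ω ∂P, ∀ t, ∀ᶠ m in atTop,
      cellSum τ (fun t ω => idleIndicator (cachedState c Y t ω)) t m ω
        = forwardedCount c Y τ t ω := by
  filter_upwards [hτ.strictMono, hτ.tendsto, hτ.counting.paths, hS] with ω h1 h2 h3 h4 t
  have h := eventually_cellSum_eq (g := fun t => idleIndicator (cachedState c Y t ω))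
    (fun u => (cachedState_eventually_eq c h4 u).mono fun v hv => by rw [hv])
    (lt_taskCount_iff h1 h2) h3.1 t
  filter_upwards [h] with m hm
  rw [forwardedCount_eq_sum c Y h1 h2]
  exact hm

/-- The increments telescope, which gives an integrable dominating variable common to all meshes. -/
theorem IsPoissonArrivals.ae_abs_cellSum_le (hτ : IsPoissonArrivals τ lamIn P)
    {χ : ℝ≥0 → Ω → ℝ} (hχ1 : ∀ t ω, |χ t ω| ≤ 1) (t : ℝ≥0) (m : ℕ) :
    ∀ᵐ ω ∂P, |cellSum τ χ t m ω| ≤ ((taskCount τ (fun _ _ => True) t ω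
      - taskCount τ (fun _ _ => True) 0 ω : ℕ) : ℝ) := by
  filter_upwards [hτ.counting.paths] with ω h
  have h1 := Finset.sum_range_tsub (h.2.1.comp (cellPoint_mono t m)) (m + 1)
  simp only [Function.comp_apply, cellPoint_last, cellPoint_zero] at h1
  rw [← h1]
  push_cast
  refine (Finset.abs_sum_le_sum_abs _ _).trans (Finset.sum_le_sum fun i _ => ?_)
  rw [abs_mul, Nat.abs_cast]
  exact mul_le_of_le_one_left (Nat.cast_nonneg _) (hχ1 _ ω)

theorem indepFun_idleIndicator_cachedState
    (hτc : IndepFun (fun ω n => τ n ω) (fun ω t => cachedState c Y t ω) P) :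
    IndepFun (fun ω n => τ n ω) (fun ω t => idleIndicator (cachedState c Y t ω)) P :=
  hτc.comp measurable_id (measurable_pi_lambda (fun (x : ℝ≥0 → Fin (C + 1)) t =>
    idleIndicator (x t)) fun t => measurable_idleIndicator.comp (measurable_pi_apply t))

theorem abs_idleIndicator_le_one (x : Fin (C + 1)) : |idleIndicator x| ≤ 1 := by
  rw [abs_of_nonneg (idleIndicator_nonneg x)]
  exact idleIndicator_le_one x

theorem IsErlangLossSystem.integral_forwardedCount (hc : IsErlangLossSystem C lam μ c P)
    (hY : ∀ k, Measurable (Y k)) (hlamIn : 0 < lamIn) (hτ : IsPoissonArrivals τ lamIn P)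
    (hS : ∀ᵐ ω ∂P, Tendsto (fun n => updateTime Y n ω) atTop atTop)
    (hτc : IndepFun (fun ω n => τ n ω) (fun ω t => cachedState c Y t ω) P)
    (hp : ∀ t, P.real {ω | 0 < cachedState c Y t ω} = p) (t : ℝ≥0) :
    Integrable (fun ω => (forwardedCount c Y τ t ω : ℝ)) P ∧
      ∫ ω, (forwardedCount c Y τ t ω : ℝ) ∂P = lamIn * p * t := by
  have hχm : ∀ t, Measurable fun ω => idleIndicator (cachedState c Y t ω) := fun t =>
    measurable_idleIndicator.comp (hc.measurable_cachedState hY t)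
  have hset : MeasurableSet {x : Fin (C + 1) | 0 < x} := (Set.toFinite _).measurableSet
  have hmean : ∀ t, ∫ ω, idleIndicator (cachedState c Y t ω) ∂P = p := fun t => by
    have h1 := integral_indicator_one (μ := P) (hc.measurable_cachedState hY t hset)
    have h2 : (fun ω => idleIndicator (cachedState c Y t ω))
        = (cachedState c Y t ⁻¹' {x | 0 < x}).indicator 1 := by
      funext ω
      simp [idleIndicator, Set.indicator_apply]
    rw [h2, h1, ← hp t]
    rfl
  have hlim := hτ.ae_eventually_cellSum_eq (c := c) hS
  have hbound := hτ.counting.integrable_increment (zero_le (a := t))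
  have hconv : ∀ᵐ ω ∂P, Tendsto (fun m => cellSum τ
      (fun t ω => idleIndicator (cachedState c Y t ω)) t m ω) atTop
      (𝓝 (forwardedCount c Y τ t ω : ℝ)) := by
    filter_upwards [hlim] with ω hω
    exact tendsto_const_nhds.congr' ((hω t).mono fun m hm => hm.symm)
  have hle := fun m => hτ.ae_abs_cellSum_le
    (fun t ω => abs_idleIndicator_le_one (cachedState c Y t ω)) t m
  constructor
  · refine hbound.mono' (aestronglyMeasurable_of_tendsto_ae atTop
      (fun m => (hτ.measurable_cellSum hχm t m).aestronglyMeasurable) hconv) ?_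
    filter_upwards [hconv, ae_all_iff.2 hle] with ω h1 h2
    exact le_of_tendsto' h1.norm h2
  · refine tendsto_nhds_unique (tendsto_integral_of_dominated_convergence _
      (fun m => (hτ.measurable_cellSum hχm t m).aestronglyMeasurable) hbound hle hconv) ?_
    simp_rw [hτ.integral_cellSum hlamIn hχm
      (fun t ω => abs_idleIndicator_le_one (cachedState c Y t ω))
      (indepFun_idleIndicator_cachedState hτc) hmean t]
    exact tendsto_const_nhds

/-- The arrival time is independent of the cache, whose right-continuity requires approximation from
above, in contrast with the left limits at update times. -/
theorem IsErlangLossSystem.measureReal_arrival_idle (hc : IsErlangLossSystem C lam μ c P)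
    (hY : ∀ k, Measurable (Y k)) (hτ : IsPoissonArrivals τ lamIn P)
    (hS : ∀ᵐ ω ∂P, Tendsto (fun n => updateTime Y n ω) atTop atTop)
    (hτc : IndepFun (fun ω n => τ n ω) (fun ω t => cachedState c Y t ω) P)
    (hp : ∀ t, P.real {ω | 0 < cachedState c Y t ω} = p) (n : ℕ) :
    P.real {ω | 0 < cachedState c Y (τ n ω) ω} = p := by
  have h0 : ∀ s, P {ω | cachedState c Y s ω ∈ {x : Fin (C + 1) | 0 < x}}
      = P {ω | 0 < cachedState c Y 0 ω} := fun s =>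
    (measureReal_eq_measureReal_iff).1 ((hp s).trans (hp 0).symm)
  have hj : ∀ m : ℕ, Measurable fun s : ℝ≥0 => ⌈((m : ℝ≥0) + 1) * s⌉₊ := fun m =>
    Nat.measurable_ceil.comp (measurable_const_mul _)
  have h := measure_independent_sample_of_eventually (P := P) (hc.measurable_cachedState hY)
    (hτ.measurable n) (hτc.symm.comp measurable_id (measurable_pi_apply n))
    (fun m k => (k : ℝ≥0) / (m + 1)) hj
    (Set.toFinite {x : Fin (C + 1) | 0 < x}).measurableSet h0
    (W := fun ω => cachedState c Y (τ n ω) ω) (by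
      filter_upwards [hS] with ω hω
      have hlim : Tendsto (fun m => gridAbove m (τ n ω)) atTop (𝓝[≥] (τ n ω)) :=
        tendsto_nhdsWithin_iff.2 ⟨tendsto_gridAbove _, .of_forall fun m => le_gridAbove m _⟩
      exact hlim.eventually (cachedState_eventually_eq c hω (τ n ω)))
  rw [← hp 0]
  exact congrArg ENNReal.toReal h

/-- The count up to n differs from `lamIn` times the idle time by a variable of second moment at
most `lamIn * n`; divided by n its squares are summable along ⌊a^m⌋. Monotonicity of the count then
gives all integers, and interpolation all real times. -/
theorem IsErlangLossSystem.ae_tendsto_forwardedCount (hc : IsErlangLossSystem C lam μ c P)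
    (hY : ∀ k, Measurable (Y k)) (hlamIn : 0 < lamIn) (hτ : IsPoissonArrivals τ lamIn P)
    (hS : ∀ᵐ ω ∂P, Tendsto (fun n => updateTime Y n ω) atTop atTop)
    (hτc : IndepFun (fun ω n => τ n ω) (fun ω t => cachedState c Y t ω) P)
    (hfrac : ∀ᵐ ω ∂P, Tendsto (fun T : ℝ => cachedIdleFraction c Y T ω) atTop (𝓝 p)) :
    ∀ᵐ ω ∂P, Tendsto (fun t : ℝ≥0 => (forwardedCount c Y τ t ω : ℝ) / t) atTop
      (𝓝 (lamIn * p)) := by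
  have hχm : ∀ t, Measurable fun ω => idleIndicator (cachedState c Y t ω) := fun t =>
    measurable_idleIndicator.comp (hc.measurable_cachedState hY t)
  obtain ⟨I, hI⟩ : ∃ I : ℕ → Ω → ℝ, ∀ n ω, I n ω
      = ∫ u in (0 : ℝ)..((n : ℝ≥0) : ℝ), idleIndicator (cachedState c Y u.toNNReal ω) :=
    ⟨_, fun _ _ => rfl⟩
  have hmom : ∀ n : ℕ,
      Integrable (fun ω => ((forwardedCount c Y τ n ω : ℝ) - lamIn * I n ω) ^ 2) P ∧
      ∫ ω, ((forwardedCount c Y τ n ω : ℝ) - lamIn * I n ω) ^ 2 ∂P ≤ lamIn * (n : ℝ≥0) := by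
    intro n
    have hsq := fun m => hτ.integral_sq_cellSum_le hlamIn hχm
      (fun t ω => abs_idleIndicator_le_one (cachedState c Y t ω))
      (indepFun_idleIndicator_cachedState hτc) (n : ℝ≥0) m
    refine integral_le_of_ae_tendsto (by positivity) (fun m ω => sq_nonneg _)
      (fun m => (hsq m).1) (fun m => (hsq m).2) ?_
    filter_upwards [hτ.ae_eventually_cellSum_eq (c := c) hS, hS] with ω h1 h2
    have h3 : Tendsto (fun m => cellSum τ (fun t ω => idleIndicator (cachedState c Y t ω))
        (n : ℝ≥0) m ω) atTop (𝓝 (forwardedCount c Y τ n ω : ℝ)) :=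
      tendsto_const_nhds.congr' ((h1 n).mono fun m hm => hm.symm)
    have h4 := tendsto_cell_riemann (g := fun t => idleIndicator (cachedState c Y t ω))
      (fun u => (cachedState_eventually_eq c h2 u).mono fun v hv => by rw [hv])
      (measurable_idleIndicator.comp (measurable_cachedState_path c h2))
      (fun u => abs_idleIndicator_le_one _) (n : ℝ≥0)
    rw [← hI] at h4
    exact (h3.sub (h4.const_mul lamIn)).pow 2
  have hsub : ∀ j : ℕ, ∀ᵐ ω ∂P, Tendsto (fun m : ℕ =>
      ((forwardedCount c Y τ (⌊(1 + 1 / ((j : ℝ) + 1)) ^ m⌋₊ : ℕ) ω : ℝ)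
        - lamIn * I ⌊(1 + 1 / ((j : ℝ) + 1)) ^ m⌋₊ ω) / (⌊(1 + 1 / ((j : ℝ) + 1)) ^ m⌋₊ : ℝ))
      atTop (𝓝 0) := by
    intro j
    set a : ℝ := 1 + 1 / ((j : ℝ) + 1) with ha
    have ha1 : 1 < a := by
      have : (0 : ℝ) < 1 / ((j : ℝ) + 1) := by positivity
      linarith
    have hone : Summable fun k : ℕ => lamIn / ((k : ℝ) + 1) ^ 2 := by
      have := ((summable_nat_add_iff 1).2 (Real.summable_one_div_nat_pow.2 one_lt_two)).mul_left
        lamIn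
      simpa [div_eq_mul_inv] using this
    have hs := summable_sum_div_floor_pow_sq (a := fun _ => lamIn) (fun _ => hlamIn.le) hone ha1
    have h := ae_summable_of_summable_integral (P := P)
      (V := fun m ω => (((forwardedCount c Y τ (⌊a ^ m⌋₊ : ℕ) ω : ℝ)
        - lamIn * I ⌊a ^ m⌋₊ ω) / (⌊a ^ m⌋₊ : ℝ)) ^ 2)
      (fun m ω => sq_nonneg _) (fun m => by
        simp_rw [div_pow]; exact (hmom _).1.div_const _)
      (Summable.of_nonneg_of_le (fun m => integral_nonneg fun ω => sq_nonneg _) (fun m => by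
        simp_rw [div_pow]
        rw [integral_div]
        refine div_le_div_of_nonneg_right ((hmom _).2.trans_eq ?_) (by positivity)
        simp [mul_comm]) hs)
    filter_upwards [h] with ω hω
    have h2 := (Real.continuous_sqrt.tendsto 0).comp hω.tendsto_atTop_zero
    rw [Real.sqrt_zero] at h2
    rw [tendsto_zero_iff_abs_tendsto_zero]
    refine h2.congr fun m => ?_
    simp [Real.sqrt_sq_eq_abs]
  filter_upwards [ae_all_iff.2 hsub, hfrac, hτ.tendsto] with ω h1 h2 h3
  have hmono := taskCount_mono h3 fun n ω => 0 < cachedState c Y (τ n ω) ω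
  have hnat : Tendsto (fun n : ℕ => (forwardedCount c Y τ n ω : ℝ) / n) atTop
      (𝓝 (lamIn * p)) := by
    refine tendsto_div_of_monotone_of_tendsto_div_floor_pow
      (fun n : ℕ => (forwardedCount c Y τ n ω : ℝ)) _
      (fun m n hmn => Nat.cast_le.2 (hmono (Nat.cast_le.2 hmn)))
      (fun j : ℕ => 1 + 1 / ((j : ℝ) + 1)) (fun j => ?_) ?_ fun j => ?_
    · have : (0 : ℝ) < 1 / ((j : ℝ) + 1) := by positivity
      linarith
    · simpa using (tendsto_const_nhds (x := (1 : ℝ))).add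
        (tendsto_one_div_add_atTop_nhds_zero_nat (𝕜 := ℝ))
    · have hj : (1 : ℝ) < 1 + 1 / ((j : ℝ) + 1) := by
        have : (0 : ℝ) < 1 / ((j : ℝ) + 1) := by positivity
        linarith
      have h4 := (h1 j).add (((h2.comp tendsto_natCast_atTop_atTop).comp
        (tendsto_floor_pow hj)).const_mul lamIn)
      rw [zero_add] at h4
      refine h4.congr fun m => ?_
      simp only [Function.comp_apply, cachedIdleFraction_eq, hI, NNReal.coe_natCast]
      ring
  refine tendsto_div_of_interpolation (N := fun t : ℝ≥0 => ⌊t⌋₊) tendsto_nat_floor_atTop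
    (s := fun n => (n : ℝ)) tendsto_natCast_atTop_atTop hnat
    (tendsto_succ_div_of_tendsto_div one_ne_zero (tendsto_const_nhds.congr' ?_))
    (fun n => Nat.cast_nonneg _) (.of_forall fun t => ⟨?_, ?_, ?_, ?_⟩)
  · filter_upwards [eventually_gt_atTop 0] with n hn
    rw [div_self (by positivity)]
  · exact_mod_cast Nat.floor_le (zero_le (a := t))
  · exact_mod_cast (Nat.lt_floor_add_one t).le
  · exact Nat.cast_le.2 (hmono (Nat.floor_le (zero_le (a := t))))
  · refine Nat.cast_le.2 (hmono ?_)
    push_cast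
    exact (Nat.lt_floor_add_one t).le

end Forwarding

/-! ### Poisson thinning by generating functions -/

section Thinning

theorem integral_pow_poissonMeasure (r : ℝ≥0) (z : ℂ) :
    ∫ k : ℕ, z ^ k ∂(poissonMeasure r) = Complex.exp (r * (z - 1)) := by
  rw [integral_poissonMeasure r]
  calc ∑' k : ℕ, (Real.exp (-r) * r ^ k / k ! : ℝ) • z ^ k
      = ∑' k : ℕ, Complex.exp (-r) * ((r * z) ^ k / k !) := by
        refine tsum_congr fun k => ?_
        rw [Complex.real_smul, mul_pow]
        push_cast
        ring
    _ = Complex.exp (-r) * Complex.exp (r * z) := by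
        rw [tsum_mul_left, (NormedSpace.expSeries_div_hasSum_exp ((r : ℂ) * z)).tsum_eq,
          Complex.exp_eq_exp_ℂ]
    _ = Complex.exp (r * (z - 1)) := by rw [← Complex.exp_add]; ring_nf

variable {Ω : Type*} [MeasurableSpace Ω] {P : Measure Ω} [IsProbabilityMeasure P]
  {ξ : ℕ → Ω → Bool} {p : ℝ}

theorem integral_mark (hξ : ∀ n, Measurable (ξ n)) (hp : ∀ n, P.real {ω | ξ n ω = true} = p)
    (w : ℂ) (j : ℕ) : ∫ ω, (if ξ j ω then w else 1) ∂P = 1 + p * (w - 1) := by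
  have hset : MeasurableSet {ω | ξ j ω = true} := hξ j (measurableSet_singleton true)
  have e : (fun ω => if ξ j ω then w else 1)
      = fun ω => 1 + {ω | ξ j ω = true}.indicator (fun _ => w - 1) ω := by
    funext ω
    by_cases h : ξ j ω = true <;> simp [h]
  rw [e, integral_add (integrable_const _) ((integrable_const _).indicator hset),
    integral_indicator hset, setIntegral_const, hp]
  simp

/-- The joint generating function of the numbers of marks in consecutive index blocks. -/
theorem integral_prod_mark_blocks (hξ : ∀ n, Measurable (ξ n)) (hind : iIndepFun ξ P)
    (hp : ∀ n, P.real {ω | ξ n ω = true} = p) {n : ℕ} (w : Fin n → ℂ) {k : Fin (n + 1) → ℕ}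
    (hk : Monotone k) :
    ∫ ω, ∏ i : Fin n, ∏ j ∈ Finset.Ico (k i.castSucc) (k i.succ), (if ξ j ω then w i else 1) ∂P
      = ∏ i : Fin n, (1 + p * (w i - 1)) ^ (k i.succ - k i.castSucc) := by
  have hsub : ∀ i : Fin n, Finset.Ico (k i.castSucc) (k i.succ)
      = (Finset.range (k (Fin.last n))).filter
        fun j => j ∈ Finset.Ico (k i.castSucc) (k i.succ) := by
    intro i
    ext j
    have : k i.succ ≤ k (Fin.last n) := hk (Fin.le_last _)
    simp only [Finset.mem_filter, Finset.mem_range, Finset.mem_Ico]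
    omega
  have huniq : ∀ (j : ℕ) (i i' : Fin n), j ∈ Finset.Ico (k i.castSucc) (k i.succ) →
      j ∈ Finset.Ico (k i'.castSucc) (k i'.succ) → i = i' := by
    intro j i i' h h'
    rw [Finset.mem_Ico] at h h'
    by_contra hne
    rcases lt_or_gt_of_ne hne with hlt | hlt
    · have : k i.succ ≤ k i'.castSucc := hk (Fin.succ_le_castSucc_iff.2 hlt)
      omega
    · have : k i'.succ ≤ k i.castSucc := hk (Fin.succ_le_castSucc_iff.2 hlt)
      omega
  -- The product over blocks becomes a product over single indices, each in at most one block, where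
  -- independence of the marks applies.
  have hswap : ∀ F : Fin n → ℕ → ℂ,
      ∏ i : Fin n, ∏ j ∈ Finset.Ico (k i.castSucc) (k i.succ), F i j
        = ∏ j : Fin (k (Fin.last n)), ∏ i : Fin n,
          if (j : ℕ) ∈ Finset.Ico (k i.castSucc) (k i.succ) then F i j else 1 := by
    intro F
    rw [← Finset.prod_range fun j => ∏ i : Fin n,
      if j ∈ Finset.Ico (k i.castSucc) (k i.succ) then F i j else 1, Finset.prod_comm]
    refine Finset.prod_congr rfl fun i _ => ?_
    rw [← Finset.prod_filter, ← hsub]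
  have hrhs : ∀ i : Fin n, (1 + p * (w i - 1)) ^ (k i.succ - k i.castSucc)
      = ∏ j ∈ Finset.Ico (k i.castSucc) (k i.succ), (1 + p * (w i - 1)) := fun i => by
    rw [Finset.prod_const, Nat.card_Ico]
  simp_rw [hrhs]
  rw [hswap fun i _ => 1 + p * (w i - 1)]
  simp_rw [fun ω => hswap fun i j => if ξ j ω then w i else 1]
  have hprec := hind.precomp (g := fun j : Fin (k (Fin.last n)) => (j : ℕ)) Fin.val_injective
  rw [hprec.integral_fun_prod_comp (fun j => (hξ j).aemeasurable)
    (f := fun (j : Fin (k (Fin.last n))) (b : Bool) => ∏ i : Fin n,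
      if (j : ℕ) ∈ Finset.Ico (k i.castSucc) (k i.succ) then (if b then w i else 1) else (1 : ℂ))
    (fun j => (measurable_of_finite _).aestronglyMeasurable)]
  refine Finset.prod_congr rfl fun j _ => ?_
  by_cases hex : ∃ i : Fin n, (j : ℕ) ∈ Finset.Ico (k i.castSucc) (k i.succ)
  · obtain ⟨i, hi⟩ := hex
    have hone : ∀ G : Fin n → ℂ, (∏ i : Fin n,
        if (j : ℕ) ∈ Finset.Ico (k i.castSucc) (k i.succ) then G i else 1) = G i := by
      intro G
      rw [Finset.prod_eq_single i, if_pos hi]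
      · intro i' _ hne
        rw [if_neg fun h => hne (huniq j i' i h hi)]
      · simp
    rw [hone]
    simp_rw [hone]
    exact integral_mark hξ hp (w i) j
  · have hone : ∀ G : Fin n → ℂ, (∏ i : Fin n,
        if (j : ℕ) ∈ Finset.Ico (k i.castSucc) (k i.succ) then G i else 1) = 1 :=
      fun G => Finset.prod_eq_one fun i _ => if_neg fun h => hex ⟨i, h⟩
    rw [hone]
    simp_rw [hone]
    simp

variable {τ : ℕ → Ω → ℝ≥0} {r : ℝ}

theorem taskCount_sub_eq_card {ω : Ω} (hm : StrictMono fun n => τ n ω)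
    (ht : Tendsto (fun n => τ n ω) atTop atTop) {s t : ℝ≥0} (hst : s ≤ t) :
    taskCount τ (fun n ω => ξ n ω = true) t ω - taskCount τ (fun n ω => ξ n ω = true) s ω
      = ((Finset.Ico (taskCount τ (fun _ _ => True) s ω)
        (taskCount τ (fun _ _ => True) t ω)).filter fun n => ξ n ω = true).card := by
  have hle := taskCount_mono ht (fun _ _ => True) hst
  dsimp only at hle
  rw [taskCount_eq_card hm ht (fun n ω => ξ n ω = true) t,
    taskCount_eq_card hm ht (fun n ω => ξ n ω = true) s]
  refine (Nat.sub_eq_of_eq_add ?_)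
  rw [Finset.range_eq_Ico, Finset.range_eq_Ico,
    ← Finset.Ico_union_Ico_eq_Ico (Nat.zero_le _) hle, Finset.filter_union,
    Finset.card_union_of_disjoint
      (Finset.disjoint_filter_filter (Finset.Ico_disjoint_Ico_consecutive _ _ _)), add_comm]

/-- Given the arrival counts, the marks in an index block of size k contribute (1 + p(w - 1))^k.
Inserting this in the generating function of independent Poisson increments multiplies the exponent
by p. -/
theorem IsPoissonArrivals.integral_prod_pow_thinned (hτ : IsPoissonArrivals τ r P) (hr : 0 < r)
    (hξ : ∀ n, Measurable (ξ n)) (hind : iIndepFun ξ P)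
    (hp : ∀ n, P.real {ω | ξ n ω = true} = p)
    (hτξ : IndepFun (fun ω n => τ n ω) (fun ω n => ξ n ω) P) {n : ℕ} (w : Fin n → ℂ)
    (hw : ∀ i, ‖w i‖ ≤ 1) {t : Fin (n + 1) → ℝ≥0} (ht : Monotone t) :
    ∫ ω, ∏ i : Fin n, w i ^ (taskCount τ (fun n ω => ξ n ω = true) (t i.succ) ω
      - taskCount τ (fun n ω => ξ n ω = true) (t i.castSucc) ω) ∂P
      = ∏ i : Fin n, Complex.exp (r * p * ((t i.succ : ℝ) - t i.castSucc) * (w i - 1)) := by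
  set N : ℝ≥0 → Ω → ℕ := taskCount τ fun _ _ => True with hN
  have hNm : ∀ u, Measurable (N u) := hτ.counting.measurable
  have hVm : Measurable fun ω (i : Fin (n + 1)) => N (t i) ω :=
    measurable_pi_lambda _ fun i => hNm (t i)
  have hξm : Measurable fun ω n => ξ n ω := measurable_pi_lambda _ hξ
  have hcount : Measurable fun (s : ℕ → ℝ≥0) (i : Fin (n + 1)) =>
      taskCount (Ω := ℕ → ℝ≥0) (fun n s => s n) (fun _ _ => True) (t i) s :=
    measurable_pi_lambda _ fun i =>
      measurable_taskCount (fun n => measurable_pi_apply n) (fun _ => MeasurableSet.univ) (t i)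
  have hVξ : IndepFun (fun ω (i : Fin (n + 1)) => N (t i) ω) (fun ω n => ξ n ω) P :=
    hτξ.comp hcount measurable_id
  -- `Ψ` sees the arrivals only through finitely many counts, a countable space, which makes joint
  -- measurability and Fubini easy.
  set Ψ : (Fin (n + 1) → ℕ) × (ℕ → Bool) → ℂ := fun q => ∏ i : Fin n,
    ∏ j ∈ Finset.Ico (q.1 i.castSucc) (q.1 i.succ), (if q.2 j then w i else 1) with hΨ
  have hΨm : Measurable Ψ := by
    refine measurable_from_prod_countable_right fun k => ?_
    change Measurable fun x : ℕ → Bool => ∏ i : Fin n,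
      ∏ j ∈ Finset.Ico (k i.castSucc) (k i.succ), (if x j then w i else 1)
    refine Finset.measurable_fun_prod _ fun i _ => Finset.measurable_fun_prod _ fun j _ => ?_
    exact (measurable_of_finite fun b : Bool => if b then w i else (1 : ℂ)).comp
      (measurable_pi_apply j)
  have hΨb : ∀ q, ‖Ψ q‖ ≤ 1 := fun q => by
    rw [hΨ]
    dsimp only
    rw [norm_prod]
    refine Finset.prod_le_one (fun _ _ => norm_nonneg _) fun i _ => ?_
    rw [norm_prod]
    refine Finset.prod_le_one (fun _ _ => norm_nonneg _) fun j _ => ?_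
    split_ifs
    · exact hw i
    · simp
  have : IsProbabilityMeasure (P.map fun ω n => ξ n ω) :=
    Measure.isProbabilityMeasure_map hξm.aemeasurable
  have : IsProbabilityMeasure (P.map fun ω (i : Fin (n + 1)) => N (t i) ω) :=
    Measure.isProbabilityMeasure_map hVm.aemeasurable
  have h1 : ∫ ω, ∏ i : Fin n, w i ^ (taskCount τ (fun n ω => ξ n ω = true) (t i.succ) ω
      - taskCount τ (fun n ω => ξ n ω = true) (t i.castSucc) ω) ∂P
      = ∫ ω, Ψ ((fun i => N (t i) ω), fun n => ξ n ω) ∂P := by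
    refine integral_congr_ae ?_
    filter_upwards [hτ.strictMono, hτ.tendsto] with ω hω1 hω2
    refine Finset.prod_congr rfl fun i _ => ?_
    rw [taskCount_sub_eq_card hω1 hω2 (ht (Fin.castSucc_le_succ i)), ← Finset.prod_const,
      Finset.prod_filter]
  have h2 : ∫ ω, Ψ ((fun i => N (t i) ω), fun n => ξ n ω) ∂P
      = ∫ k, ∫ x, Ψ (k, x) ∂(P.map fun ω n => ξ n ω)
        ∂(P.map fun ω (i : Fin (n + 1)) => N (t i) ω) := by
    rw [← integral_prod Ψ (Integrable.of_bound hΨm.aestronglyMeasurable 1 (.of_forall hΨb)),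
      ← hVξ.map_prod_eq_prod_map_map hVm.aemeasurable hξm.aemeasurable,
      integral_map (hVm.prodMk hξm).aemeasurable hΨm.aestronglyMeasurable]
  have h3 : ∫ k, ∫ x, Ψ (k, x) ∂(P.map fun ω n => ξ n ω)
        ∂(P.map fun ω (i : Fin (n + 1)) => N (t i) ω)
      = ∫ ω, ∏ i : Fin n, (1 + p * (w i - 1)) ^ (N (t i.succ) ω - N (t i.castSucc) ω) ∂P := by
    rw [integral_map hVm.aemeasurable
      (hΨm.stronglyMeasurable.integral_prod_right').aestronglyMeasurable]
    refine integral_congr_ae ?_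
    filter_upwards [hτ.tendsto] with ω hω
    have hm : Measurable fun x => Ψ ((fun i => N (t i) ω), x) := hΨm.comp measurable_prodMk_left
    rw [integral_map hξm.aemeasurable hm.aestronglyMeasurable]
    exact integral_prod_mark_blocks hξ hind hp w
      (k := fun i => N (t i) ω) ((taskCount_mono hω fun _ _ => True).comp ht)
  rw [h1, h2, h3, (hτ.counting.indepIncrements n t ht).integral_fun_prod_comp
    (f := fun i (k : ℕ) => (1 + p * (w i - 1)) ^ k)
    (fun i => ((hNm _).sub (hNm _)).aemeasurable)
    (fun i => Measurable.of_discrete.aestronglyMeasurable)]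
  refine Finset.prod_congr rfl fun i _ => ?_
  have hst : t i.castSucc ≤ t i.succ := ht (Fin.castSucc_le_succ i)
  have h4 := integral_pow_poissonMeasure
    (r * ((t i.succ : ℝ) - (t i.castSucc : ℝ))).toNNReal (1 + p * (w i - 1))
  have hd : Measurable fun ω => taskCount τ (fun _ _ => True) (t i.succ) ω
      - taskCount τ (fun _ _ => True) (t i.castSucc) ω := (hNm _).sub (hNm _)
  rw [← hτ.counting.increments _ _ hst, integral_map hd.aemeasurable
    Measurable.of_discrete.aestronglyMeasurable, Real.coe_toNNReal _
      (mul_nonneg hr.le (sub_nonneg.2 (NNReal.coe_le_coe.2 hst)))] at h4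
  refine h4.trans ?_
  congr 1
  push_cast
  ring

/-- At w_i = exp(iθ_i) the generating function is the joint characteristic function of the
increments: its product form gives independence and each factor is Poisson. -/
theorem IsPoissonArrivals.isPoissonCounting_thinned (hτ : IsPoissonArrivals τ r P) (hr : 0 < r)
    (hp0 : 0 ≤ p) (hξ : ∀ n, Measurable (ξ n)) (hind : iIndepFun ξ P)
    (hp : ∀ n, P.real {ω | ξ n ω = true} = p)
    (hτξ : IndepFun (fun ω n => τ n ω) (fun ω n => ξ n ω) P) :
    IsPoissonCounting (taskCount τ fun n ω => ξ n ω = true) (r * p) P := by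
  set M : ℝ≥0 → Ω → ℕ := taskCount τ fun n ω => ξ n ω = true with hM
  have hMm : ∀ t, Measurable (M t) := fun t =>
    measurable_taskCount hτ.measurable (fun n => hξ n (measurableSet_singleton true)) t
  have hcast : Measurable fun k : ℕ => (k : ℝ) := Measurable.of_discrete
  have hdm : ∀ s t, Measurable fun ω => ((M t ω - M s ω : ℕ) : ℝ) := fun s t =>
    hcast.comp ((hMm t).sub (hMm s))
  have hgen := fun {n : ℕ} (w : Fin n → ℂ) (hw : ∀ i, ‖w i‖ ≤ 1) {t : Fin (n + 1) → ℝ≥0}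
    (ht : Monotone t) => hτ.integral_prod_pow_thinned hr hξ hind hp hτξ w hw ht
  have hexp : ∀ (θ : ℝ) (k : ℕ),
      Complex.exp (θ * (k : ℝ) * Complex.I) = Complex.exp (θ * Complex.I) ^ k := fun θ k => by
    rw [← Complex.exp_nat_mul]
    push_cast
    ring_nf
  have hnorm : ∀ θ : ℝ, ‖Complex.exp (θ * Complex.I)‖ ≤ 1 := fun θ =>
    (Complex.norm_exp_ofReal_mul_I θ).le
  have hchar : ∀ {s t : ℝ≥0}, s ≤ t → ∀ θ : ℝ,
      charFun (P.map fun ω => ((M t ω - M s ω : ℕ) : ℝ)) θ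
        = Complex.exp (r * p * ((t : ℝ) - s) * (Complex.exp (θ * Complex.I) - 1)) := by
    intro s t hst θ
    rw [charFun_apply_real, integral_map (hdm s t).aemeasurable
      (by fun_prop)]
    simp_rw [hexp]
    have h := hgen (n := 1) (fun _ => Complex.exp (θ * Complex.I)) (fun _ => hnorm θ)
      (t := ![s, t]) (by
        intro i j hij
        fin_cases i <;> fin_cases j <;> simp_all)
    simpa using h
  refine ⟨hMm, ?_, ?_, ?_⟩
  · filter_upwards [hτ.counting.paths, hτ.strictMono, hτ.tendsto] with ω h1 h2 h3
    have hle : ∀ t, M t ω = ((Finset.range (taskCount τ (fun _ _ => True) t ω)).filter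
        fun n => ξ n ω = true).card := fun t => taskCount_eq_card h2 h3 _ t
    refine ⟨?_, taskCount_mono h3 _, fun t => ?_⟩
    · rw [hle, h1.1]
      simp
    · have h4 := h1.2.2 t
      have h5 : (fun s => M s ω) = (fun k : ℕ => ((Finset.range k).filter
          fun n => ξ n ω = true).card) ∘ fun s => taskCount τ (fun _ _ => True) s ω :=
        funext hle
      rw [h5]
      exact continuous_of_discreteTopology.continuousAt.comp_continuousWithinAt h4
  · intro n t ht
    have hreal : iIndepFun (fun (i : Fin n) ω => ((M (t i.succ) ω - M (t i.castSucc) ω : ℕ) : ℝ))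
        P := by
      rw [iIndepFun_iff_charFun_pi fun i =>
        (hdm _ _).aemeasurable]
      intro θ
      have hm : Measurable fun ω => WithLp.toLp 2 fun i : Fin n =>
          ((M (t i.succ) ω - M (t i.castSucc) ω : ℕ) : ℝ) :=
        (WithLp.measurable_toLp 2 _).comp
          (measurable_pi_lambda _ fun i => hdm _ _)
      rw [charFun_apply, integral_map hm.aemeasurable (by fun_prop)]
      simp_rw [hchar (ht (Fin.castSucc_le_succ _))]
      rw [← hgen (fun i => Complex.exp (θ i * Complex.I)) (fun i => hnorm (θ i)) ht]
      refine integral_congr_ae (.of_forall fun ω => ?_)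
      dsimp only
      rw [PiLp.inner_apply]
      push_cast
      rw [Finset.sum_mul, Complex.exp_sum]
      refine Finset.prod_congr rfl fun i _ => ?_
      rw [← hexp]
      congr 1
      simp [hM]
    -- Characteristic functions treat the increments as reals; the floor recovers the natural
    -- numbers.
    have h := hreal.comp (fun _ x => ⌊x⌋₊) fun _ => Nat.measurable_floor
    simpa [Function.comp_def] using h
  · intro s t hst
    have h1 : (P.map fun ω => ((M t ω - M s ω : ℕ) : ℝ))
        = (poissonMeasure (r * p * ((t : ℝ) - (s : ℝ))).toNNReal).map (Nat.cast : ℕ → ℝ) := by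
      have : IsProbabilityMeasure (P.map fun ω => ((M t ω - M s ω : ℕ) : ℝ)) :=
        Measure.isProbabilityMeasure_map (hdm s t).aemeasurable
      refine Measure.ext_of_charFun (funext fun θ => ?_)
      rw [hchar hst, charFun_map_cast_poissonMeasure, Real.coe_toNNReal _
        (mul_nonneg (mul_nonneg hr.le hp0) (sub_nonneg.2 (NNReal.coe_le_coe.2 hst)))]
      push_cast
      rfl
    have h2 := congrArg (Measure.map fun x : ℝ => ⌊x⌋₊) h1
    rw [Measure.map_map Nat.measurable_floor (hdm s t),
      Measure.map_map Nat.measurable_floor hcast] at h2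
    simpa [Function.comp_def, Measure.map_id'] using h2

end Thinning

/-! ### Assembly of the four claims -/

theorem lemma1 {Ω : Type*} [MeasurableSpace Ω] (P : Measure Ω) [IsProbabilityMeasure P]
    (C : ℕ) (hC : 1 ≤ C) (lam μ lamIn r : ℝ)
    (hlam : 0 < lam) (hμ : 0 < μ) (hlamIn : 0 < lamIn) (hr : 0 < r)
    -- the server, the status updates and the user tasks
    (c : ℝ≥0 → Ω → Fin (C + 1)) (hc : IsErlangLossSystem C lam μ c P)
    (Y : ℕ → Ω → ℝ≥0) (hY : IsUpdateGaps Y r P)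
    (τ : ℕ → Ω → ℝ≥0) (hτ : IsPoissonArrivals τ lamIn P)
    -- the update times are independent of the server's queueing process
    (hcY : IndepFun (fun ω t => c t ω) (fun ω k => Y k ω) P)
    -- the user tasks are independent of the cached state
    (hτc : IndepFun (fun ω n => τ n ω) (fun ω t => cachedState c Y t ω) P) :
    -- long-run fraction of time during which the cache shows an idle thread
    (∀ᵐ ω ∂P, Tendsto (fun T : ℝ => cachedIdleFraction c Y T ω) atTop (𝓝 (pIdle lam μ C))) ∧
    -- in steady state, the probabilities of an idle thread at the server, in the cache at a
    -- given time, and in the cache seen by the `n`-th task; mean number of forwarded tasks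
    (InSteadyState c P →
      (∀ t, P.real {ω | 0 < c t ω} = pIdle lam μ C) ∧
      (∀ t, P.real {ω | 0 < cachedState c Y t ω} = pIdle lam μ C) ∧
      (∀ n, P.real {ω | 0 < cachedState c Y (τ n ω) ω} = pIdle lam μ C) ∧
      (∀ t : ℝ≥0, Integrable (fun ω => (forwardedCount c Y τ t ω : ℝ)) P ∧
        ∫ ω, (forwardedCount c Y τ t ω : ℝ) ∂P = lamIn * pIdle lam μ C * t)) ∧
    -- long-run rate of the forwarded tasks
    (∀ᵐ ω ∂P, Tendsto (fun t : ℝ≥0 => (forwardedCount c Y τ t ω : ℝ) / t) atTop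
      (𝓝 (lamIn * pIdle lam μ C))) ∧
    -- hence the fixed-point relation, when the server is fed at the forwarding rate
    ((∀ᵐ ω ∂P, Tendsto (fun t : ℝ≥0 => (forwardedCount c Y τ t ω : ℝ) / t) atTop (𝓝 lam)) →
      lam = lamIn * pIdle lam μ C) ∧
    -- Poisson thinning: forwarding each task independently with this probability gives a
    -- Poisson process
    (∀ ξ : ℕ → Ω → Bool, (∀ n, Measurable (ξ n)) → iIndepFun ξ P →
      (∀ n, P.real {ω | ξ n ω = true} = pIdle lam μ C) →
      IndepFun (fun ω n => τ n ω) (fun ω n => ξ n ω) P →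
      IsPoissonCounting (taskCount τ fun n ω => ξ n ω = true) (lamIn * pIdle lam μ C) P) := by
  have hS : ∀ᵐ ω ∂P, Tendsto (fun n => updateTime Y n ω) atTop atTop := by
    filter_upwards [hY.ae_tendsto_average] with ω hω using tendsto_updateTime hr hω
  have hfrac : ∀ᵐ ω ∂P,
      Tendsto (fun T : ℝ => cachedIdleFraction c Y T ω) atTop (𝓝 (pIdle lam μ C)) := by
    filter_upwards [hY.ae_tendsto_average, hc.ae_tendsto_update_average hlam hμ hY hcY]
      with ω h1 h2 using tendsto_cachedIdleFraction hr c h1 h2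
  have hrate := hc.ae_tendsto_forwardedCount hY.measurable hlamIn hτ hS hτc hfrac
  refine ⟨hfrac, fun hs => ?_, hrate, fun h => ?_, fun ξ hξ hind hp hτξ => ?_⟩
  · have hp := hc.measureReal_cached_idle_of_inSteadyState hlam hμ hY.measurable hcY hs
    exact ⟨hc.measureReal_idle_of_inSteadyState hlam hμ hs, hp,
      hc.measureReal_arrival_idle hY.measurable hτ hS hτc hp,
      hc.integral_forwardedCount hY.measurable hlamIn hτ hS hτc hp⟩
  -- Two almost sure limits of the same function hold together at some ω, hence coincide.
  · obtain ⟨ω, h1, h2⟩ := (h.and hrate).exists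
    exact tendsto_nhds_unique h1 h2
  · exact hτ.isPoissonCounting_thinned hlamIn (pIdle_nonneg hlam hμ) hξ hind hp hτξ
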